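/- Theorem 1.1 (Reiner–Stanton–White). For $n\ge 0$ let $X$ be the set of noncrossing set partitions of $[n]=\{1,\dots,n\}$, that is, of those set partitions for which, whenever $1\le a<b<c<d\le n$ with $a,c$ in a common block and $b,d$ in a common block, all of $a,b,c,d$ lie in one block. Let the cyclic group $C=\mathbb Z_n=\langle c\rangle$ act on $X$ by rotation: $c$ is the long cycle $(1,2,\dots,n)$ and replaces each block by its image (for $n=0$, $C$ is the trivial group). Put $[r]_q=1+q+\cdots+q^{r-1}$, $[m]!_q=[m]_q[m-1]_q\cdots[1]_q$, ${n \brack k}_q=\frac{[n]!_q}{[k]!_q\,[n-k]!_q}$ for $0\le k\le n$, and let $$X(q)=\mathsf{Cat}_q(n)=\frac{1}{[n+1]_q}{2n \brack n}_q$$ be the $q$-Catalan number. Then the triple $(X,C,X(q))$ exhibits the cyclic sieving phenomenon: $X(q)$ is a polynomial in $q$ with nonnegative integer coefficients, and for every root of unity $\zeta\in\mathbb C$ of multiplicative order $|C|$ and every integer $d\ge 0$, $$\#\{x\in X : c^d\cdot x=x\}=X(\zeta^d).$$ -/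

import Mathlib

/-! ### Set partitions of `[n]` and the action of permutations on them

The ground set `[n] = {1, …, n}` is modelled by `Fin n = {0, …, n - 1}` with its usual order. -/

/-- Set partitions of `[n]`: finite sets of pairwise disjoint nonempty blocks with union `[n]`. -/
abbrev SetPartition (n : ℕ) : Type := Finpartition (Finset.univ : Finset (Fin n))

namespace SetPartition

/-- The set partition `w(π)`, whose blocks are the images `w(B)` of the blocks `B` of `π`. -/
def permute {n : ℕ} (w : Equiv.Perm (Fin n)) (π : SetPartition n) : SetPartition n :=
  Finpartition.ofExistsUnique (π.parts.image fun B => B.image w)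
    (fun B _ => Finset.subset_univ B)
    (by
      intro a _
      obtain ⟨B, ⟨hB, haB⟩, huniq⟩ := π.existsUnique_mem (Finset.mem_univ (w⁻¹ a))
      refine ⟨B.image w, ⟨Finset.mem_image_of_mem _ hB,
        Finset.mem_image.2 ⟨w⁻¹ a, haB, by simp⟩⟩, ?_⟩
      rintro B' ⟨hB', haB'⟩
      obtain ⟨D, hD, rfl⟩ := Finset.mem_image.1 hB'
      obtain ⟨x, hx, rfl⟩ := Finset.mem_image.1 haB'
      rw [huniq D ⟨hD, by simpa using hx⟩])
    (by
      intro h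
      obtain ⟨B, hB, hB'⟩ := Finset.mem_image.1 h
      exact π.ne_empty hB (Finset.image_eq_empty.1 hB'))

theorem parts_permute {n : ℕ} (w : Equiv.Perm (Fin n)) (π : SetPartition n) :
    (permute w π).parts = π.parts.image fun B => B.image w := rfl

/-- The permutation action of the symmetric group on set partitions, `w • π = w(π)`. -/
instance instMulActionPerm (n : ℕ) : MulAction (Equiv.Perm (Fin n)) (SetPartition n) where
  smul := permute
  one_smul π := by
    apply Finpartition.ext
    change (permute 1 π).parts = π.parts
    simp [parts_permute]
  mul_smul v w π := by
    apply Finpartition.ext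
    change (permute (v * w) π).parts = (permute v (permute w π)).parts
    simp only [parts_permute, Finset.image_image, Equiv.Perm.coe_mul]
    congr 1
    funext B
    simp [Finset.image_image]

theorem parts_smul {n : ℕ} (w : Equiv.Perm (Fin n)) (π : SetPartition n) :
    (w • π).parts = π.parts.image fun B => B.image w := rfl

/-- A set partition is noncrossing if whenever `a < b < c < d` with `a, c` in one block and `b, d`
in one block, these two blocks coincide. -/
def IsNoncrossing {n : ℕ} (π : SetPartition n) : Prop :=
  ∀ a b c d : Fin n, a < b → b < c → c < d →
    ∀ B ∈ π.parts, ∀ B' ∈ π.parts, a ∈ B → c ∈ B → b ∈ B' → d ∈ B' → B = B'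

end SetPartition

/-! ### Rotation of noncrossing partitions -/

/-- The cyclic group `C = ⟨c⟩` of rotations of `[n]`, generated by the long cycle
`c = (1, 2, …, n)`. It is cyclic of order `n` for `n ≥ 1`, and trivial for `n = 0`. -/
abbrev rotationGroup (n : ℕ) : Subgroup (Equiv.Perm (Fin n)) :=
  Subgroup.zpowers (finRotate n)

/-- The generator `c = (1, 2, …, n)` of the group of rotations. -/
def longCycle (n : ℕ) : rotationGroup n :=
  ⟨finRotate n, Subgroup.mem_zpowers (finRotate n)⟩

theorem card_rotationGroup {n : ℕ} (hn : 1 ≤ n) : Nat.card (rotationGroup n) = n := by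
  rw [Nat.card_zpowers]
  obtain _ | _ | m := n
  · omega
  · have : finRotate 1 = 1 := Subsingleton.elim _ _
    simp [this]
  · rw [(isCycle_finRotate (n := m)).orderOf, support_finRotate]
    simp

theorem SetPartition.IsNoncrossing.finRotate_smul {n : ℕ} {π : SetPartition n}
    (hπ : π.IsNoncrossing) : (finRotate n • π).IsNoncrossing := by
  obtain _ | m := n
  · intro a
    exact a.elim0
  intro a b c d hab hbc hcd B hB B' hB' ha hc hb hd
  rw [SetPartition.parts_smul] at hB hB'
  obtain ⟨D, hD, rfl⟩ := Finset.mem_image.1 hB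
  obtain ⟨D', hD', rfl⟩ := Finset.mem_image.1 hB'
  obtain ⟨a', ha', rfl⟩ := Finset.mem_image.1 ha
  obtain ⟨b', hb', rfl⟩ := Finset.mem_image.1 hb
  obtain ⟨c', hc', rfl⟩ := Finset.mem_image.1 hc
  obtain ⟨d', hd', rfl⟩ := Finset.mem_image.1 hd
  have key : ∀ x : Fin (m + 1), ((finRotate (m + 1) x : Fin (m + 1)) : ℕ) =
      if (x : ℕ) = m then 0 else (x : ℕ) + 1 := by
    intro x
    rw [coe_finRotate]
    simp [Fin.ext_iff]
  have h1 := key a'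
  have h2 := key b'
  have h3 := key c'
  have h4 := key d'
  have l1 := a'.is_lt
  have l4 := d'.is_lt
  rw [Fin.lt_def] at hab hbc hcd
  congr 1
  by_cases h : (a' : ℕ) = m
  · refine (hπ b' c' d' a' ?_ ?_ ?_ D' hD' D hD hb' hd' hc' ha').symm <;> rw [Fin.lt_def] <;>
      split_ifs at h1 h2 h3 h4 <;> omega
  · refine hπ a' b' c' d' ?_ ?_ ?_ D hD D' hD' ha' hc' hb' hd' <;> rw [Fin.lt_def] <;>
      split_ifs at h1 h2 h3 h4 <;> omega

theorem SetPartition.IsNoncrossing.smul_of_mem {n : ℕ} {π : SetPartition n}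
    (hπ : π.IsNoncrossing) {w : Equiv.Perm (Fin n)} (hw : w ∈ rotationGroup n) :
    (w • π).IsNoncrossing := by
  obtain ⟨k, rfl⟩ := mem_powers_iff_mem_zpowers.2 hw
  change (finRotate n ^ k • π).IsNoncrossing
  induction k with
  | zero => simpa using hπ
  | succ k ih =>
    rw [pow_succ', mul_smul]
    exact (ih (pow_mem (Subgroup.mem_zpowers _) k)).finRotate_smul

/-- The set `NC(n)` of noncrossing partitions of `[n]`. -/
abbrev NC (n : ℕ) : Type := {π : SetPartition n // π.IsNoncrossing}

/-- Rotations act on noncrossing partitions of `[n]` by `w • π = w(π)`. -/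
instance instMulActionNC (n : ℕ) : MulAction (rotationGroup n) (NC n) where
  smul w π := ⟨(w : Equiv.Perm (Fin n)) • π.1, π.2.smul_of_mem w.2⟩
  one_smul π := Subtype.ext (one_smul (Equiv.Perm (Fin n)) π.1)
  mul_smul v w π :=
    Subtype.ext (mul_smul (v : Equiv.Perm (Fin n)) (w : Equiv.Perm (Fin n)) π.1)

/-! ### The cyclic sieving phenomenon -/

/-- Let `C = ⟨c⟩` be a finite cyclic group acting on a finite set `X`, and `P` a polynomial with
nonnegative integer coefficients. The triple `(X, C, P)` exhibits the cyclic sieving phenomenon if,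
for `ζ ∈ ℂ` a root of unity of multiplicative order `|C|` and every `d ≥ 0`, the number of fixed
points of `c ^ d` on `X` equals `P(ζ ^ d)`. -/
structure ExhibitsCSP (X : Type*) {C : Type*} [Group C] [MulAction C X] (c : C)
    (P : Polynomial ℕ) : Prop where
  finite_set : Finite X
  finite_group : Finite C
  generates : Subgroup.zpowers c = ⊤
  card_fixedBy : ∀ ζ : ℂ, IsPrimitiveRoot ζ (Nat.card C) → ∀ d : ℕ,
    (Nat.card (MulAction.fixedBy X (c ^ d)) : ℂ) = Polynomial.aeval (ζ ^ d) P

/-! ### `q`-analogues, as elements of the field `ℚ(q)` of rational functions -/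

noncomputable section

/-- `[r]_q = 1 + q + ⋯ + q ^ (r - 1)`. -/
def qInt (r : ℕ) : RatFunc ℚ := ∑ i ∈ Finset.range r, RatFunc.X ^ i

/-- `[m]!_q = [m]_q [m - 1]_q ⋯ [1]_q`. -/
def qFactorial (m : ℕ) : RatFunc ℚ := ∏ i ∈ Finset.range m, qInt (i + 1)

/-- The `q`-binomial coefficient `[n]!_q / ([k]!_q [n - k]!_q)`, which is zero for `k > n`. -/
def qBinomial (n k : ℕ) : RatFunc ℚ :=
  if k ≤ n then qFactorial n / (qFactorial k * qFactorial (n - k)) else 0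

/-- The `q`-Catalan number `1 / [n + 1]_q` times the `q`-binomial coefficient of `2n` and `n`. -/
def qCatalan (n : ℕ) : RatFunc ℚ := 1 / qInt (n + 1) * qBinomial (2 * n) n

end

/-! For n ≥ 1 both sides depend only on g = gcd(n, d). Put m = n / g, so that ω = ζ^d is a primitive
m-th root of unity. Both sides equal the Catalan number of n if m = 1, and the central binomial
coefficient binom(2g, g) if m ≥ 2.

Algebra. The q-Catalan number is the diagonal case of the q-ballot numbers B(a, b) = [a+b choose b]
- q [a+b choose b-1]. Their differences in b obey a recursion with nonnegative coefficients
(`qBallot_succ_succ`), so induction gives a polynomial over ℕ. For its values, start from X(q) [n+1]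
[n]!^2 = [2n]!. Since [ml]! is [m]^l times a cofactor whose value at ω is l! K^l with K ≠ 0
(`exists_qFactorial_cofactor`), cancelling [m]^(2g) before evaluating leaves X(ω) [n+1]_ω =
binom(2g, g). Here [n+1]_ω is n + 1 if m = 1, and 1 if m ≥ 2.

Combinatorics. Pull a partition back to ℤ along residues mod n. It is fixed by c^d exactly when the
pullback is invariant under translation by g. If m ≥ 2, at most one block is invariant under
rotation by g, and the lift of any other block falls into pieces of diameter less than g. Cutting
into these pieces (`shortRel`) gives a g-periodic noncrossing relation on ℤ, and reducing mod n
(`modRel`) inverts this. As in matching parentheses, such a relation is determined by the least and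
greatest elements of its classes within one period, and any two subsets of a period of equal size
occur. This gives the sum of binom(g, k)^2, which is binom(2g, g) (`card_periodicNC`). If m = 1, the
pullback is cut at the multiples of n instead; the pairs of subsets are then ballot pairs, that is,
Dyck words (`card_NC`). -/

open Polynomial

/-! ### q-integers as polynomials over ℕ -/

/-- The embedding `ℕ[q] → ℚ(q)`. -/
noncomputable def natPolyToRatFunc : ℕ[X] →+* RatFunc ℚ :=
  (algebraMap ℚ[X] (RatFunc ℚ)).comp (Polynomial.mapRingHom (Nat.castRingHom ℚ))

theorem natPolyToRatFunc_apply (P : ℕ[X]) :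
    natPolyToRatFunc P = algebraMap ℚ[X] (RatFunc ℚ) (P.map (Nat.castRingHom ℚ)) := rfl

theorem natPolyToRatFunc_injective : Function.Injective natPolyToRatFunc := fun _ _ h =>
  Polynomial.map_injective _ (Nat.cast_injective (R := ℚ))
    (RatFunc.algebraMap_injective ℚ h)

theorem natPolyToRatFunc_X : natPolyToRatFunc X = RatFunc.X := by
  simp [natPolyToRatFunc_apply]

theorem qInt_eq_natPoly (r : ℕ) :
    qInt r = natPolyToRatFunc (∑ i ∈ Finset.range r, X ^ i) := by
  simp [qInt, natPolyToRatFunc_X]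

theorem qFactorial_eq_natPoly (m : ℕ) : qFactorial m =
    natPolyToRatFunc (∏ j ∈ Finset.range m, ∑ i ∈ Finset.range (j + 1), X ^ i) := by
  simp [qFactorial, qInt_eq_natPoly]

theorem qInt_succ_ne_zero (r : ℕ) : qInt (r + 1) ≠ 0 := by
  rw [qInt_eq_natPoly, Ne, map_eq_zero_iff _ natPolyToRatFunc_injective]
  intro h
  have := congrArg (Polynomial.eval 1) h
  simp [Polynomial.eval_finsetSum] at this

theorem qFactorial_succ (m : ℕ) : qFactorial (m + 1) = qFactorial m * qInt (m + 1) :=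
  Finset.prod_range_succ _ _

theorem qFactorial_zero : qFactorial 0 = 1 := rfl

theorem qFactorial_ne_zero (m : ℕ) : qFactorial m ≠ 0 :=
  Finset.prod_ne_zero_iff.2 fun i _ => qInt_succ_ne_zero i

theorem RatFunc.X_ne_one : (RatFunc.X : RatFunc ℚ) ≠ 1 := by
  rw [← natPolyToRatFunc_X, ← map_one natPolyToRatFunc]
  exact fun h => Polynomial.X_ne_C (1 : ℕ) (by simpa using natPolyToRatFunc_injective h)

theorem qInt_eq_div (r : ℕ) : qInt r = (1 - RatFunc.X ^ r) / (1 - RatFunc.X) := by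
  rw [qInt, geom_sum_eq RatFunc.X_ne_one, ← neg_sub 1 RatFunc.X, ← neg_sub 1 (RatFunc.X ^ r),
    neg_div_neg_eq]

theorem one_sub_X_pow_succ_ne_zero (r : ℕ) : (1 - RatFunc.X ^ (r + 1) : RatFunc ℚ) ≠ 0 := by
  intro h
  exact qInt_succ_ne_zero r (by rw [qInt_eq_div, h, zero_div])

/-! ### Nonnegativity of the q-Catalan numbers via q-ballot numbers -/

/-- The `q`-ballot number: the generating function for the major index of ballot sequences
with `a` votes for the first and `b` votes for the second candidate. -/
noncomputable def qBallot (a b : ℕ) : RatFunc ℚ :=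
  qFactorial (a + b) * (qInt (a + 1) - RatFunc.X * qInt b) / (qFactorial b * qFactorial (a + 1))

theorem qBallot_zero_right (a : ℕ) : qBallot a 0 = 1 := by
  have h1 := qFactorial_ne_zero a
  have h2 := qInt_succ_ne_zero a
  rw [qBallot, qFactorial_succ, qFactorial_zero]
  simp only [add_zero, qInt, Finset.range_zero, Finset.sum_empty, mul_zero, sub_zero, one_mul]
  exact div_self (mul_ne_zero h1 h2)

theorem qBallot_self (n : ℕ) : qBallot n n = qCatalan n := by
  have h1 := qFactorial_ne_zero n
  have h2 := qInt_succ_ne_zero n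
  have h3 : qInt (n + 1) - RatFunc.X * qInt n = 1 := by
    rw [qInt, qInt, Finset.sum_range_succ', Finset.mul_sum]
    simp [pow_succ']
  rw [qBallot, h3, qCatalan, qBinomial, if_pos (by omega), qFactorial_succ,
    show 2 * n - n = n by omega, ← two_mul]
  field_simp

/-- The recursion is for differences in `b`, because there every coefficient is nonnegative. -/
theorem qBallot_succ_succ (a b : ℕ) :
    qBallot (a + 1) (b + 1) - qBallot (a + 1) b =
      (qBallot a (b + 1) - qBallot a b) + RatFunc.X ^ (a + b + 1) * qBallot a b := by
  have h1 := qFactorial_ne_zero a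
  have h2 := qFactorial_ne_zero b
  have h3 := one_sub_X_pow_succ_ne_zero a
  have h4 := one_sub_X_pow_succ_ne_zero (a + 1)
  have h5 := one_sub_X_pow_succ_ne_zero b
  have h6 : (1 - RatFunc.X : RatFunc ℚ) ≠ 0 := sub_ne_zero.2 RatFunc.X_ne_one.symm
  simp only [qBallot, show a + 1 + (b + 1) = a + b + 1 + 1 by ring,
    show a + (b + 1) = a + b + 1 by ring, show a + 1 + b = a + b + 1 by ring, qFactorial_succ,
    qInt_eq_div]
  generalize (RatFunc.X : RatFunc ℚ) = q at *
  field_simp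
  ring

theorem qBallot_self_eq (a : ℕ) : qBallot (a + 1) (a + 1) = qBallot (a + 1) a := by
  have h1 := qFactorial_ne_zero a
  have h3 := one_sub_X_pow_succ_ne_zero a
  have h4 := one_sub_X_pow_succ_ne_zero (a + 1)
  have h6 : (1 - RatFunc.X : RatFunc ℚ) ≠ 0 := sub_ne_zero.2 RatFunc.X_ne_one.symm
  simp only [qBallot, show a + 1 + (a + 1) = a + a + 1 + 1 by ring,
    show a + 1 + a = a + a + 1 by ring, qFactorial_succ,
    qInt_eq_div]
  generalize (RatFunc.X : RatFunc ℚ) = q at *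
  field_simp
  ring

/-- The differences are carried along in the induction: subtraction is unavailable over ℕ, and the
recursion expresses a new difference by an old difference and an old value. -/
theorem qBallot_mem_rangeS (a : ℕ) : ∀ b ≤ a, qBallot a b ∈ natPolyToRatFunc.rangeS ∧
    ∀ c, b = c + 1 → qBallot a b - qBallot a c ∈ natPolyToRatFunc.rangeS := by
  induction a with
  | zero =>
    rintro b hb
    obtain rfl : b = 0 := by omega
    exact ⟨by rw [qBallot_zero_right]; exact one_mem _, fun c hc => by omega⟩
  | succ a iha =>
    intro b
    induction b with
    | zero =>
      exact fun _ => ⟨by rw [qBallot_zero_right]; exact one_mem _, fun c hc => by omega⟩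
    | succ b ihb =>
      intro hb
      have key : qBallot (a + 1) (b + 1) - qBallot (a + 1) b ∈ natPolyToRatFunc.rangeS := by
        -- At b = a the recursion would involve `qBallot a (a + 1)`, beyond the diagonal. That
        -- quantity vanishes at q = 1 without being zero, so it is not in ℕ[q].
        obtain rfl | h : b = a ∨ b + 1 ≤ a := by omega
        · rw [qBallot_self_eq, sub_self]
          exact zero_mem _
        · rw [qBallot_succ_succ]
          exact add_mem ((iha _ h).2 b rfl) (mul_mem
            (pow_mem (RingHom.mem_rangeS.2 ⟨X, natPolyToRatFunc_X⟩) _)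
            (iha b (by omega)).1)
      refine ⟨?_, fun c hc => ?_⟩
      · rw [← sub_add_cancel (qBallot (a + 1) (b + 1)) (qBallot (a + 1) b)]
        exact add_mem key (ihb (by omega)).1
      · obtain rfl : b = c := by omega
        exact key

theorem exists_natPoly_eq_qCatalan (n : ℕ) : ∃ P : ℕ[X], natPolyToRatFunc P = qCatalan n := by
  rw [← qBallot_self]
  exact (qBallot_mem_rangeS n n le_rfl).1

theorem natPoly_mul_eq_of_eq_qCatalan {n : ℕ} {P : ℕ[X]} (hP : natPolyToRatFunc P = qCatalan n) :
    P * (∑ i ∈ Finset.range (n + 1), X ^ i) *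
      ((∏ j ∈ Finset.range n, ∑ i ∈ Finset.range (j + 1), X ^ i) ^ 2) =
    ∏ j ∈ Finset.range (2 * n), ∑ i ∈ Finset.range (j + 1), (X : ℕ[X]) ^ i := by
  apply natPolyToRatFunc_injective
  rw [map_mul, map_mul, map_pow, hP, ← qInt_eq_natPoly, ← qFactorial_eq_natPoly,
    ← qFactorial_eq_natPoly, qCatalan, qBinomial, if_pos (by omega),
    show 2 * n - n = n by omega]
  have h1 := qFactorial_ne_zero n
  have h2 := qInt_succ_ne_zero n
  field_simp

/-! ### Values at roots of unity -/

/-- The `q`-factorial of `m * l` has the `l`-th power of `[m]` as a factor; the value of the cofactor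
at a primitive `m`-th root of unity is `l!` up to powers of a nonzero constant. -/
theorem exists_qFactorial_cofactor {m : ℕ} (hm : 0 < m) {ω : ℂ} (hω : IsPrimitiveRoot ω m) :
    ∃ (K : ℂ) (R : ℕ → ℂ[X]), K ≠ 0 ∧ (∀ l, (R l).eval ω = l.factorial * K ^ l) ∧
      ∀ l, ∏ j ∈ Finset.range (m * l), ∑ i ∈ Finset.range (j + 1), (X : ℂ[X]) ^ i =
        (∑ i ∈ Finset.range m, X ^ i) ^ l * R l := by
  obtain ⟨k, rfl⟩ : ∃ k, m = k + 1 := ⟨m - 1, by omega⟩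
  have hω1 := hω.pow_eq_one
  have hval : ∀ l r, ∑ i ∈ Finset.range ((k + 1) * l + r + 1), ω ^ i * (ω - 1) =
      ω ^ (r + 1) - 1 := by
    intro l r
    rw [← Finset.sum_mul, geom_sum_mul, add_assoc, pow_add, pow_mul, hω1, one_pow, one_mul]
  -- The factors of [ml]! are grouped in runs of m = k + 1. In run t, the last factor is [m(t+1)]_q
  -- = [m]_q [t+1]_(q^m), with second factor t + 1 at ω; the others have the values [1], ..., [m-1]
  -- at ω, with product K.
  refine ⟨∏ r ∈ Finset.range k, ∑ i ∈ Finset.range (r + 1), ω ^ i,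
    fun l => ∏ t ∈ Finset.range l, ((∏ r ∈ Finset.range k,
      ∑ i ∈ Finset.range ((k + 1) * t + r + 1), X ^ i) *
        ∑ i ∈ Finset.range (t + 1), (X ^ (k + 1)) ^ i), ?_, ?_, ?_⟩
  · refine Finset.prod_ne_zero_iff.2 fun r hr h => ?_
    have h' := geom_sum_mul ω (r + 1)
    rw [h, zero_mul, eq_comm, sub_eq_zero] at h'
    exact hω.pow_ne_one_of_pos_of_lt (by omega) (by simpa using hr) h'
  · intro l
    rw [eval_prod]
    induction l with
    | zero => simp
    | succ l ih =>
      rw [Finset.prod_range_succ, ih, eval_mul, eval_prod]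
      have h1 : ∀ r ∈ Finset.range k,
          (∑ i ∈ Finset.range ((k + 1) * l + r + 1), (X : ℂ[X]) ^ i).eval ω =
            ∑ i ∈ Finset.range (r + 1), ω ^ i := by
        intro r hr
        have hω2 : ω - 1 ≠ 0 := by
          rw [sub_ne_zero]
          rintro rfl
          exact hω.pow_ne_one_of_pos_of_lt (l := 1) (by omega)
            (by simp at hr; omega) (one_pow 1)
        apply mul_right_cancel₀ hω2
        rw [eval_finsetSum]
        simp only [eval_pow, eval_X]
        rw [Finset.sum_mul, hval, ← geom_sum_mul]
      rw [Finset.prod_congr rfl h1, eval_finsetSum]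
      simp only [eval_pow, eval_X, hω1, one_pow, Finset.sum_const, Finset.card_range,
        nsmul_eq_mul, mul_one, Nat.factorial_succ]
      push_cast
      ring
  · intro l
    induction l with
    | zero => simp
    | succ l ih =>
      have h2 : ∑ i ∈ Finset.range ((k + 1) * l + k + 1), (X : ℂ[X]) ^ i =
          (∑ i ∈ Finset.range (k + 1), X ^ i) * ∑ i ∈ Finset.range (l + 1), (X ^ (k + 1)) ^ i := by
        have hX : (X - 1 : ℂ[X]) ≠ 0 := sub_ne_zero.2 (by simpa using Polynomial.X_ne_C (R := ℂ) 1)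
        apply mul_right_cancel₀ hX
        rw [mul_right_comm, geom_sum_mul, geom_sum_mul, mul_geom_sum, ← pow_mul]
        congr 2
      rw [mul_add, mul_one, Finset.prod_range_add, ih, Finset.prod_range_succ]
      rw [show ∀ F : ℕ → ℂ[X], (fun l => ∏ t ∈ Finset.range l, F t) (l + 1) =
        (fun l => ∏ t ∈ Finset.range l, F t) l * F l from fun F => Finset.prod_range_succ F l, h2,
        pow_succ (∑ i ∈ Finset.range (k + 1), (X : ℂ[X]) ^ i)]
      simp only [mul_assoc, mul_comm, mul_left_comm]

theorem aeval_mul_geom_sum_eq_centralBinom {m l : ℕ} (hm : 0 < m) {P : ℕ[X]}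
    (hP : natPolyToRatFunc P = qCatalan (m * l)) {ω : ℂ} (hω : IsPrimitiveRoot ω m) :
    aeval ω P * ∑ i ∈ Finset.range (m * l + 1), ω ^ i = Nat.centralBinom l := by
  obtain ⟨K, R, hK, hR, hfac⟩ := exists_qFactorial_cofactor hm hω
  have h := congrArg (Polynomial.map (Nat.castRingHom ℂ)) (natPoly_mul_eq_of_eq_qCatalan hP)
  simp only [Polynomial.map_mul, Polynomial.map_pow, Polynomial.map_prod, Polynomial.map_sum,
    Polynomial.map_X] at h
  rw [show 2 * (m * l) = m * (2 * l) by ring, hfac, hfac] at h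
  have hne : (∑ i ∈ Finset.range m, (X : ℂ[X]) ^ i) ≠ 0 := by
    intro h0
    have := congrArg (Polynomial.eval 1) h0
    simp [Polynomial.eval_finsetSum] at this
    omega
  -- The power of [m] has to be cancelled between polynomials, since [m] vanishes at ω when m ≥ 2.
  have h' : P.map (Nat.castRingHom ℂ) * (∑ i ∈ Finset.range (m * l + 1), X ^ i) * R l ^ 2 =
      R (2 * l) := by
    apply mul_left_cancel₀ (pow_ne_zero (2 * l) hne)
    rw [← h]
    ring
  have h2 := congrArg (Polynomial.eval ω) h'
  simp only [eval_mul, eval_pow, hR, eval_finsetSum, eval_X] at h2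
  have h3 : (P.map (Nat.castRingHom ℂ)).eval ω = aeval ω P := by
    rw [eval_map, aeval_def]
    rfl
  rw [h3] at h2
  have h4 : ((2 * l).factorial : ℂ) = Nat.centralBinom l * (l.factorial : ℂ) ^ 2 := by
    rw [Nat.centralBinom, ← Nat.choose_mul_factorial_mul_factorial (show l ≤ 2 * l by omega),
      show 2 * l - l = l by omega]
    push_cast
    ring
  have h5 : ((l.factorial : ℂ) * K ^ l) ^ 2 ≠ 0 :=
    pow_ne_zero _ (mul_ne_zero (by exact_mod_cast l.factorial_ne_zero) (pow_ne_zero _ hK))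
  apply mul_right_cancel₀ h5
  rw [h2, h4]
  ring

theorem aeval_qCatalan_one {n : ℕ} {P : ℕ[X]} (hP : natPolyToRatFunc P = qCatalan n) :
    aeval (1 : ℂ) P = catalan n := by
  have h := aeval_mul_geom_sum_eq_centralBinom (m := 1) (l := n) one_pos (P := P)
    (by rwa [one_mul]) IsPrimitiveRoot.one
  have h1 : ((n + 1 : ℕ) : ℂ) ≠ 0 := Nat.cast_ne_zero.2 n.succ_ne_zero
  apply mul_right_cancel₀ h1
  rw [← succ_mul_catalan_eq_centralBinom] at h
  simpa [mul_comm] using h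

theorem aeval_qCatalan_of_isPrimitiveRoot {m l : ℕ} (hm : 2 ≤ m) {P : ℕ[X]}
    (hP : natPolyToRatFunc P = qCatalan (m * l)) {ω : ℂ} (hω : IsPrimitiveRoot ω m) :
    aeval ω P = Nat.centralBinom l := by
  rw [← aeval_mul_geom_sum_eq_centralBinom (by omega) hP hω]
  have : ∑ i ∈ Finset.range (m * l + 1), ω ^ i = 1 := by
    apply mul_right_cancel₀ (sub_ne_zero.2 (hω.ne_one (by omega)))
    rw [geom_sum_mul, pow_succ, pow_mul, hω.pow_eq_one]
    simp
  rw [this, mul_one]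

/-! ### Periodic noncrossing equivalence relations on the integers -/

/-- Invariance of an equivalence relation on `ℤ` under translation by `g`. -/
def Setoid.IsShiftInvariant (s : Setoid ℤ) (g : ℤ) : Prop :=
  ∀ x y, s (x + g) (y + g) ↔ s x y

/-- Noncrossing equivalence relations on `ℤ`. -/
def Setoid.IsIntNoncrossing (s : Setoid ℤ) : Prop :=
  ∀ a b c d, a < b → b < c → c < d → s a c → s b d → s a b

/-- `x` is the least element of its class. -/
def Setoid.IsOpener (s : Setoid ℤ) (x : ℤ) : Prop := ∀ y, s x y → x ≤ y

/-- `x` is the greatest element of its class. -/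
def Setoid.IsCloser (s : Setoid ℤ) (x : ℤ) : Prop := ∀ y, s x y → y ≤ x

open Classical in
/-- The indicator of a proposition, as an integer. -/
noncomputable def intInd (p : Prop) : ℤ := if p then 1 else 0

theorem intInd_of {p : Prop} (h : p) : intInd p = 1 := if_pos h
theorem intInd_of_not {p : Prop} (h : ¬p) : intInd p = 0 := if_neg h
theorem intInd_nonneg (p : Prop) : 0 ≤ intInd p := by
  unfold intInd; split_ifs <;> simp
theorem intInd_le_one (p : Prop) : intInd p ≤ 1 := by
  unfold intInd; split_ifs <;> simp

namespace Setoid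

variable {s : Setoid ℤ} {g : ℤ}

theorem IsShiftInvariant.neg (hs : s.IsShiftInvariant g) : s.IsShiftInvariant (-g) := fun x y => by
  rw [← hs (x + -g) (y + -g)]; simp

theorem IsShiftInvariant.add {g' : ℤ} (hs : s.IsShiftInvariant g) (hs' : s.IsShiftInvariant g') :
    s.IsShiftInvariant (g + g') := fun x y => by
  rw [← add_assoc, ← add_assoc, hs', hs]

theorem IsShiftInvariant.mul (hs : s.IsShiftInvariant g) (k : ℤ) :
    s.IsShiftInvariant (k * g) := by
  induction k using Int.induction_on with
  | zero => intro x y; simp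
  | succ k ih => rw [add_mul, one_mul]; exact ih.add hs
  | pred k ih => rw [sub_mul, one_mul, sub_eq_add_neg]; exact ih.add hs.neg

/-- If a class contains two elements at distance at least `g`, it is invariant under
translation by `g`. -/
theorem rel_add_of_add_le (hg : 0 < g) (hs : s.IsShiftInvariant g) (hn : s.IsIntNoncrossing)
    {x y : ℤ} (h : s x y) (hxy : x + g ≤ y) : s x (x + g) := by
  obtain rfl | hlt := hxy.eq_or_lt
  · exact h
  · exact hn x (x + g) y (y + g) (by omega) hlt (by omega) h ((hs x y).2 h)

/-- A longer class would be invariant under translation by `g`, hence have no least element. -/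
theorem IsOpener.lt_add (hg : 0 < g) (hs : s.IsShiftInvariant g) (hn : s.IsIntNoncrossing)
    {x y : ℤ} (hx : s.IsOpener x) (h : s x y) : y < x + g := by
  by_contra! hle
  have h2 : s (x - g) x := by
    rw [← hs, sub_add_cancel]
    exact rel_add_of_add_le hg hs hn h hle
  have := hx _ (s.symm' h2)
  omega

theorem IsCloser.lt_add (hg : 0 < g) (hs : s.IsShiftInvariant g) (hn : s.IsIntNoncrossing)
    {x y : ℤ} (hy : s.IsCloser y) (h : s x y) : y < x + g := by
  by_contra! hle
  have h1 := rel_add_of_add_le hg hs hn h hle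
  have h2 : s y (y + g) := s.trans' (s.symm' h) (s.trans' h1 ((hs x y).2 h))
  have := hy _ h2
  omega

theorem exists_isOpener {x b : ℤ} (hb : ∀ y, s x y → b ≤ y) :
    ∃ o, s x o ∧ s.IsOpener o ∧ b ≤ o := by
  obtain ⟨o, ho, hmin⟩ := Int.exists_least_of_bdd (P := fun y => s x y) ⟨b, hb⟩ ⟨x, s.refl' x⟩
  exact ⟨o, ho, fun y hy => hmin y (s.trans' ho hy), hb o ho⟩

/-! ### Heights of a periodic noncrossing relation -/

/-- The openers whose class reaches from below `k` to `k` or beyond. -/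
def openBefore (s : Setoid ℤ) (k : ℤ) : Set ℤ := {x | s.IsOpener x ∧ x < k ∧ ∃ y, s x y ∧ k ≤ y}

/-- The openers whose class reaches from at most `k` to `k` or beyond. -/
def openAt (s : Setoid ℤ) (k : ℤ) : Set ℤ := {x | s.IsOpener x ∧ x ≤ k ∧ ∃ y, s x y ∧ k ≤ y}

theorem openBefore_finite (hg : 0 < g) (hs : s.IsShiftInvariant g) (hn : s.IsIntNoncrossing)
    (k : ℤ) : (s.openBefore k).Finite := by
  refine (Set.finite_Icc (k - g) k).subset ?_
  rintro x ⟨hx, hxk, y, hxy, hky⟩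
  have := hx.lt_add hg hs hn hxy
  exact ⟨by omega, by omega⟩

theorem openAt_finite (hg : 0 < g) (hs : s.IsShiftInvariant g) (hn : s.IsIntNoncrossing)
    (k : ℤ) : (s.openAt k).Finite := by
  refine (Set.finite_Icc (k - g) k).subset ?_
  rintro x ⟨hx, hxk, y, hxy, hky⟩
  have := hx.lt_add hg hs hn hxy
  exact ⟨by omega, by omega⟩

/-- The number of finite classes separated by the gap before `k`. -/
noncomputable def height (s : Setoid ℤ) (k : ℤ) : ℤ := (s.openBefore k).ncard

theorem ncard_openAt (hg : 0 < g) (hs : s.IsShiftInvariant g) (hn : s.IsIntNoncrossing) (k : ℤ) :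
    ((s.openAt k).ncard : ℤ) = s.height k + intInd (s.IsOpener k) := by
  by_cases hk : s.IsOpener k
  · have : s.openAt k = insert k (s.openBefore k) := by
      ext x
      simp only [openAt, openBefore, Set.mem_ofPred_eq, Set.mem_insert_iff]
      constructor
      · rintro ⟨h1, h2, h3⟩
        obtain h | h := h2.eq_or_lt
        · exact Or.inl h
        · exact Or.inr ⟨h1, h, h3⟩
      · rintro (rfl | ⟨h1, h2, h3⟩)
        · exact ⟨hk, le_rfl, x, s.refl' x, le_rfl⟩
        · exact ⟨h1, h2.le, h3⟩
    rw [this, Set.ncard_insert_of_notMem (fun h => lt_irrefl _ h.2.1)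
      (openBefore_finite hg hs hn k), intInd_of hk, height]
    push_cast
    rfl
  · have : s.openAt k = s.openBefore k := by
      ext x
      refine ⟨fun ⟨h1, h2, h3⟩ => ⟨h1, lt_of_le_of_ne h2 ?_, h3⟩, fun ⟨h1, h2, h3⟩ => ⟨h1, h2.le, h3⟩⟩
      rintro rfl
      exact hk h1
    rw [this, intInd_of_not hk, height, add_zero]

theorem height_add_one_eq (hg : 0 < g) (hs : s.IsShiftInvariant g) (hn : s.IsIntNoncrossing)
    (k : ℤ) : s.height (k + 1) = (s.openAt k).ncard - intInd (s.IsCloser k) := by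
  by_cases hk : s.IsCloser k
  · obtain ⟨o, hko, ho, -⟩ := s.exists_isOpener (x := k) (b := k - g) fun y hy => by
      have := hk.lt_add hg hs hn (s.symm' hy)
      omega
    have : s.openAt k = insert o (s.openBefore (k + 1)) := by
      ext x
      simp only [openAt, openBefore, Set.mem_ofPred_eq, Set.mem_insert_iff]
      constructor
      · rintro ⟨h1, h2, y, hxy, hky⟩
        obtain rfl | h := hky.eq_or_lt
        · exact Or.inl (le_antisymm (h1 _ (s.trans' hxy hko)) (ho _ (s.trans' (s.symm' hko)
            (s.symm' hxy))))
        · exact Or.inr ⟨h1, by omega, y, hxy, h⟩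
      · rintro (rfl | ⟨h1, h2, y, hxy, hky⟩)
        · exact ⟨ho, ho _ (s.symm' hko), k, s.symm' hko, le_rfl⟩
        · exact ⟨h1, by omega, y, hxy, by omega⟩
    rw [this, Set.ncard_insert_of_notMem _ (openBefore_finite hg hs hn _), intInd_of hk, height]
    · push_cast
      ring
    · rintro ⟨-, -, y, hy, hky⟩
      have := hk y (s.trans' hko hy)
      omega
  · have : s.openAt k = s.openBefore (k + 1) := by
      ext x
      refine ⟨fun ⟨h1, h2, y, hxy, hky⟩ => ⟨h1, by omega, ?_⟩,
        fun ⟨h1, h2, y, hxy, hky⟩ => ⟨h1, by omega, y, hxy, by omega⟩⟩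
      obtain rfl | h := hky.eq_or_lt
      · simp only [IsCloser, not_forall, not_le] at hk
        obtain ⟨z, hz, hlt⟩ := hk
        exact ⟨z, s.trans' hxy hz, hlt⟩
      · exact ⟨y, hxy, h⟩
    rw [this, intInd_of_not hk, height, sub_zero]

theorem height_add_one (hg : 0 < g) (hs : s.IsShiftInvariant g) (hn : s.IsIntNoncrossing) (k : ℤ) :
    s.height (k + 1) = s.height k + intInd (s.IsOpener k) - intInd (s.IsCloser k) := by
  rw [height_add_one_eq hg hs hn, ncard_openAt hg hs hn]

/-- By noncrossing, a class other than that of `i` and `j` spans both points or neither. -/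
theorem openAt_eq_of_rel (hn : s.IsIntNoncrossing) {i j : ℤ} (hij : i < j) (h : s i j) :
    s.openAt i = s.openAt j := by
  ext x
  constructor
  · rintro ⟨hx, hxi, y, hxy, hiy⟩
    refine ⟨hx, by omega, ?_⟩
    by_cases hxi' : s x i
    · exact ⟨j, s.trans' hxi' h, le_rfl⟩
    · refine ⟨y, hxy, ?_⟩
      by_contra! hyj
      have h1 : x ≠ i := by rintro rfl; exact hxi' (s.refl' x)
      have h2 : i ≠ y := by rintro rfl; exact hxi' hxy
      exact hxi' (hn x i y j (by omega) (by omega) (by omega) hxy h)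
  · rintro ⟨hx, hxj, y, hxy, hjy⟩
    by_cases hxi' : s x i
    · exact ⟨hx, hx _ hxi', i, hxi', le_rfl⟩
    · have h1 : x ≠ j := by rintro rfl; exact hxi' (s.symm' h)
      have h2 : j ≠ y := by rintro rfl; exact hxi' (s.trans' hxy (s.symm' h))
      refine ⟨hx, ?_, y, hxy, by omega⟩
      by_contra! hlt
      exact hxi' (s.symm' (hn i x j y (by omega) (by omega) (by omega) h hxy))

theorem openAt_subset_openBefore (hn : s.IsIntNoncrossing) {i j k : ℤ} (hik : i < k) (hkj : k ≤ j)
    (h : s i j) : s.openAt i ⊆ s.openBefore k := by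
  have hij : i < j := by omega
  intro x hx
  obtain ⟨h1, h2, -⟩ := id hx
  rw [openAt_eq_of_rel hn hij h] at hx
  obtain ⟨-, -, y, hxy, hjy⟩ := hx
  exact ⟨h1, by omega, y, hxy, by omega⟩

theorem rel_of_height_le (hg : 0 < g) (hs : s.IsShiftInvariant g) (hn : s.IsIntNoncrossing)
    (N : ℕ) : ∀ i j : ℤ, i < j → j ≤ i + N → (s.openAt i).ncard = (s.openAt j).ncard →
      (∀ k, i < k → k ≤ j → ((s.openAt i).ncard : ℤ) ≤ s.height k) → s i j := by
  induction N with
  | zero => intro i j hij hN; push_cast at hN; omega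
  | succ N ih =>
    intro i j hij hN hH hA
    have hcl : ¬ s.IsCloser i := by
      intro hc
      have := hA (i + 1) (by omega) (by omega)
      rw [height_add_one_eq hg hs hn, intInd_of hc] at this
      omega
    simp only [IsCloser, not_forall, not_le] at hcl
    -- Let i' be the next element of the class of i. If i' > j, the class of j cannot reach i or
    -- below, so it has an opener o > i. Opening at o makes the count at o, which is that at j,
    -- exceed the height before o, hence also the count at i: a contradiction.
    obtain ⟨y, hy, hiy⟩ := hcl
    obtain ⟨i', ⟨hi', hii'⟩, hmin⟩ := Int.exists_least_of_bdd (P := fun y => s i y ∧ i < y)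
      ⟨i, fun z hz => hz.2.le⟩ ⟨y, hy, hiy⟩
    have hHi' := openAt_eq_of_rel hn hii' hi'
    by_contra hnij
    obtain h | rfl | h := lt_trichotomy i' j
    · refine hnij (s.trans' hi' (ih i' j h (by push_cast at hN; omega) (by rw [← hHi', hH]) ?_))
      intro k hk hkj
      rw [← hHi']
      exact hA k (by omega) hkj
    · exact hnij hi'
    · obtain ⟨o, hjo, ho, hio⟩ := s.exists_isOpener (x := j) (b := i + 1) fun z hz => by
        by_contra! hlt
        have h1 : z ≠ i := by rintro rfl; exact hnij (s.symm' hz)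
        exact hnij (s.symm' (s.trans' hz (hn z i j i' (by omega) hij h (s.symm' hz) hi')))
      have hoj : o ≤ j := ho _ (s.symm' hjo)
      have hHo : (s.openAt o).ncard = (s.openAt j).ncard := by
        obtain rfl | hlt := hoj.eq_or_lt
        · rfl
        · rw [openAt_eq_of_rel hn hlt (s.symm' hjo)]
      have h1 := ncard_openAt hg hs hn o
      rw [intInd_of ho] at h1
      have h2 := hA o (by omega) hoj
      omega

/-- A periodic noncrossing relation is determined by its heights. -/
theorem rel_iff_height (hg : 0 < g) (hs : s.IsShiftInvariant g) (hn : s.IsIntNoncrossing)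
    (i j : ℤ) : s i j ↔
      s.height i + intInd (s.IsOpener i) = s.height j + intInd (s.IsOpener j) ∧
      ∀ k, min i j < k → k ≤ max i j → s.height i + intInd (s.IsOpener i) ≤ s.height k := by
  have key : ∀ i j : ℤ, i < j → (s i j ↔
      s.height i + intInd (s.IsOpener i) = s.height j + intInd (s.IsOpener j) ∧
      ∀ k, i < k → k ≤ j → s.height i + intInd (s.IsOpener i) ≤ s.height k) := by
    intro i j hij
    simp only [← ncard_openAt hg hs hn]
    constructor
    · intro h
      refine ⟨by rw [openAt_eq_of_rel hn hij h], fun k hik hkj => ?_⟩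
      rw [height, Nat.cast_le]
      exact Set.ncard_le_ncard (openAt_subset_openBefore hn hik hkj h)
        (openBefore_finite hg hs hn k)
    · rintro ⟨h1, h2⟩
      exact rel_of_height_le hg hs hn (j - i).toNat i j hij (by omega) (by exact_mod_cast h1) h2
  obtain h | rfl | h := lt_trichotomy i j
  · rw [min_eq_left h.le, max_eq_right h.le, key i j h]
  · simp only [min_self, max_self, true_and]
    exact ⟨fun _ k hk hk' => by omega, fun _ => s.refl' i⟩
  · rw [min_eq_right h.le, max_eq_left h.le, s.comm', key j i h]
    constructor <;> rintro ⟨h1, h2⟩ <;> refine ⟨h1.symm, ?_⟩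
    · rwa [← h1]
    · rwa [← h1]

/-- Openers and closers fix the heights up to an additive constant, and the criterion
`rel_iff_height` is insensitive to that constant. -/
theorem eq_of_isOpener_iff {s' : Setoid ℤ} (hg : 0 < g) (hs : s.IsShiftInvariant g)
    (hn : s.IsIntNoncrossing) (hs' : s'.IsShiftInvariant g) (hn' : s'.IsIntNoncrossing)
    (ho : ∀ k, s.IsOpener k ↔ s'.IsOpener k) (hc : ∀ k, s.IsCloser k ↔ s'.IsCloser k) :
    s = s' := by
  have hconst : ∀ k, s.height k = s'.height k + (s.height 0 - s'.height 0) := by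
    intro k
    induction k using Int.induction_on with
    | zero => ring
    | succ k ih =>
      rw [height_add_one hg hs hn, height_add_one hg hs' hn', ho, hc, ih]
      ring
    | pred k ih =>
      have h1 := height_add_one hg hs hn (-k - 1)
      have h2 := height_add_one hg hs' hn' (-k - 1)
      rw [ho, hc] at h1
      rw [show -(k : ℤ) - 1 + 1 = -k by ring] at h1 h2
      omega
  ext i j
  rw [rel_iff_height hg hs hn, rel_iff_height hg hs' hn']
  simp only [ho, hconst i, hconst j]
  refine and_congr (by omega) (forall_congr' fun k => imp_congr_right fun _ =>
    imp_congr_right fun _ => ?_)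
  rw [hconst k]
  omega

theorem IsShiftInvariant.isOpener_add (hs : s.IsShiftInvariant g) (k : ℤ) :
    s.IsOpener (k + g) ↔ s.IsOpener k := by
  constructor
  · intro h y hy
    have := h (y + g) ((hs _ _).2 hy)
    omega
  · intro h y hy
    have := h (y - g) ((hs _ _).1 (by simpa using hy))
    omega

theorem IsShiftInvariant.isCloser_add (hs : s.IsShiftInvariant g) (k : ℤ) :
    s.IsCloser (k + g) ↔ s.IsCloser k := by
  constructor
  · intro h y hy
    have := h (y + g) ((hs _ _).2 hy)
    omega
  · intro h y hy
    have := h (y - g) ((hs _ _).1 (by simpa using hy))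
    omega

theorem height_add_period (hs : s.IsShiftInvariant g) (k : ℤ) :
    s.height (k + g) = s.height k := by
  rw [height, height]
  congr 1
  rw [← Set.ncard_image_of_injective (s.openBefore k) (add_left_injective g)]
  congr 1
  ext x
  simp only [openBefore, Set.mem_ofPred_eq, Set.mem_image]
  constructor
  · rintro ⟨h1, h2, y, hxy, hky⟩
    refine ⟨x - g, ⟨?_, by omega, y - g, ?_, by omega⟩, by ring⟩
    · rw [← hs.isOpener_add]; simpa using h1
    · rw [← hs]; simpa using hxy
  · rintro ⟨x, ⟨h1, h2, y, hxy, hky⟩, rfl⟩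
    exact ⟨(hs.isOpener_add x).2 h1, by omega, y + g, (hs _ _).2 hxy, by omega⟩

end Setoid

/-! ### Building a relation from prescribed heights -/

/-- The equivalence relation on `ℤ` read off from a sequence of heights. -/
def heightSetoid (H A : ℤ → ℤ) : Setoid ℤ where
  r i j := H i = H j ∧ ∀ k, min i j < k → k ≤ max i j → H i ≤ A k
  iseqv := by
    refine ⟨fun i => ⟨rfl, fun k h1 h2 => by omega⟩, fun {i j} ⟨h1, h2⟩ => ⟨h1.symm, ?_⟩,
      fun {i j l} ⟨h1, h2⟩ ⟨h3, h4⟩ => ⟨h1.trans h3, ?_⟩⟩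
    · rw [min_comm, max_comm, ← h1]
      exact h2
    · intro k hk hk'
      by_cases h : min i j < k ∧ k ≤ max i j
      · exact h2 k h.1 h.2
      · rw [h1]
        exact h4 k (by omega) (by omega)

theorem heightSetoid_apply (H A : ℤ → ℤ) (i j : ℤ) : heightSetoid H A i j ↔
    H i = H j ∧ ∀ k, min i j < k → k ≤ max i j → H i ≤ A k := Iff.rfl

theorem heightSetoid_isIntNoncrossing {H A : ℤ → ℤ} (hHA : ∀ k, A k ≤ H k) :
    (heightSetoid H A).IsIntNoncrossing := by
  intro a b c d hab hbc hcd hac hbd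
  rw [heightSetoid_apply] at *
  rw [min_eq_left (by omega), max_eq_right (by omega)] at *
  have h1 := hHA b
  have h2 := hHA c
  have h3 := hac.2 b hab hbc.le
  have h4 := hbd.2 c hbc hcd.le
  exact ⟨by omega, fun k hk hkb => hac.2 k hk (by omega)⟩

theorem heightSetoid_isShiftInvariant {H A : ℤ → ℤ} {g : ℤ} (hH : ∀ k, H (k + g) = H k)
    (hA : ∀ k, A (k + g) = A k) : (heightSetoid H A).IsShiftInvariant g := by
  intro i j
  simp only [heightSetoid_apply, hH]
  refine and_congr_right fun _ => ⟨fun h k hk hk' => ?_, fun h k hk hk' => ?_⟩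
  · rw [← hA]
    exact h (k + g) (by omega) (by omega)
  · have := hA (k - g)
    rw [sub_add_cancel] at this
    rw [this]
    exact h (k - g) (by omega) (by omega)

section heightSetoid

variable {A : ℤ → ℤ} {L R : ℤ → Prop} {g : ℤ}

/-- At an element of `L` the path has just risen, so nothing to the left is visible at that level.
Elsewhere a partner on the left exists, because periodicity makes the level recur. -/
theorem heightSetoid_isOpener_iff (hg : 0 < g) (hA : ∀ k, A (k + g) = A k)
    (hL : ∀ k, L (k + g) ↔ L k)
    (hstep : ∀ k, A (k + 1) = A k + intInd (L k) - intInd (R k)) (i : ℤ) :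
    (heightSetoid (fun k => A k + intInd (L k)) A).IsOpener i ↔ L i := by
  constructor
  · intro h
    by_contra hi
    have hper : A (i - g) + intInd (L (i - g)) = A i + intInd (L i) := by
      rw [← hA (i - g), ← hL (i - g), sub_add_cancel]
    -- The nearest j < i at level at most that of i. The path stays at or above this level from j +
    -- 1 to i, which forces equal levels and makes j a smaller member of the class of i.
    obtain ⟨j, ⟨hji, hj⟩, hmax⟩ := Int.exists_greatest_of_bdd
      (P := fun j => j < i ∧ A j + intInd (L j) ≤ A i + intInd (L i)) ⟨i, fun z hz => hz.1.le⟩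
      ⟨i - g, by omega, hper.le⟩
    rw [intInd_of_not hi] at hj hmax
    have hge : ∀ k, j < k → k ≤ i → A i ≤ A k := by
      intro k hk hki
      obtain rfl | hlt := hki.eq_or_lt
      · exact le_rfl
      · have h1 : ¬ (k < i ∧ A k + intInd (L k) ≤ A i + 0) := fun h' => by
          have := hmax k h'
          omega
        have := intInd_le_one (L k)
        omega
    have h1 := hge (j + 1) (by omega) (by omega)
    rw [hstep] at h1
    have h2 := intInd_nonneg (R j)
    have h3 := h j (by
      rw [heightSetoid_apply, intInd_of_not hi, min_eq_right hji.le, max_eq_left hji.le]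
      exact ⟨by omega, fun k hk hki => by rw [add_zero]; exact hge k hk hki⟩)
    omega
  · intro hi j hij
    by_contra! hlt
    have h1 := hij.2 i (by omega) (by omega)
    simp only [intInd_of hi] at h1
    omega

theorem heightSetoid_isCloser_iff (hg : 0 < g) (hA : ∀ k, A (k + g) = A k)
    (hL : ∀ k, L (k + g) ↔ L k)
    (hstep : ∀ k, A (k + 1) = A k + intInd (L k) - intInd (R k)) (i : ℤ) :
    (heightSetoid (fun k => A k + intInd (L k)) A).IsCloser i ↔ R i := by
  constructor
  · intro h
    by_contra hi
    have hper : A (i + g) + intInd (L (i + g)) = A i + intInd (L i) := by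
      rw [hA, hL]
    obtain ⟨j, ⟨hij, hj⟩, hmin⟩ := Int.exists_least_of_bdd
      (P := fun j => i < j ∧ A j + intInd (L j) ≤ A i + intInd (L i)) ⟨i, fun z hz => hz.1.le⟩
      ⟨i + g, by omega, hper.le⟩
    have hi1 := hstep i
    rw [intInd_of_not hi] at hi1
    have hge : ∀ k, i < k → k ≤ j → A i + intInd (L i) ≤ A k := by
      intro k hk hkj
      obtain rfl | hlt := (show i + 1 ≤ k from hk).eq_or_lt
      · omega
      · have h1 : ¬ (i < k - 1 ∧ A (k - 1) + intInd (L (k - 1)) ≤ A i + intInd (L i)) :=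
          fun h' => by
            have := hmin _ h'
            omega
        have h2 := hstep (k - 1)
        rw [sub_add_cancel] at h2
        have := intInd_le_one (R (k - 1))
        omega
    have h1 := hge j hij le_rfl
    have h2 := intInd_nonneg (L j)
    have h3 := h j (by
      rw [heightSetoid_apply, min_eq_left hij.le, max_eq_right hij.le]
      exact ⟨by omega, hge⟩)
    omega
  · intro hi j hij
    by_contra! hlt
    have h1 := hij.2 (i + 1) (by omega) (by omega)
    rw [hstep, intInd_of hi] at h1
    simp only at h1
    omega

end heightSetoid

/-! ### Encoding by openers and closers -/

/-- Pairs of subsets of `{0, …, g - 1}` of equal size. -/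
def balancedPairs (g : ℕ) : Finset (Finset ℕ × Finset ℕ) :=
  {p ∈ (Finset.range g).powerset ×ˢ (Finset.range g).powerset | p.1.card = p.2.card}

/-- The excess of elements of `p.1` over elements of `p.2` below `r`. -/
noncomputable def pairExcess (p : Finset ℕ × Finset ℕ) (r : ℕ) : ℤ :=
  ∑ x ∈ Finset.range r, (intInd (x ∈ p.1) - intInd (x ∈ p.2))

theorem pairExcess_zero (p : Finset ℕ × Finset ℕ) : pairExcess p 0 = 0 := rfl

theorem pairExcess_succ (p : Finset ℕ × Finset ℕ) (r : ℕ) :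
    pairExcess p (r + 1) = pairExcess p r + (intInd (r ∈ p.1) - intInd (r ∈ p.2)) :=
  Finset.sum_range_succ _ _

theorem sum_intInd_mem {S T : Finset ℕ} (h : S ⊆ T) : ∑ x ∈ T, intInd (x ∈ S) = S.card := by
  rw [Finset.card_eq_sum_ones, Nat.cast_sum,
    ← Finset.sum_subset h fun x _ hx => intInd_of_not hx]
  exact Finset.sum_congr rfl fun x hx => intInd_of hx

theorem pairExcess_eq_card_sub_card {g : ℕ} {p : Finset ℕ × Finset ℕ} (h1 : p.1 ⊆ Finset.range g)
    (h2 : p.2 ⊆ Finset.range g) : pairExcess p g = p.1.card - p.2.card := by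
  rw [pairExcess, Finset.sum_sub_distrib, sum_intInd_mem h1, sum_intInd_mem h2]

theorem mem_balancedPairs_iff {g : ℕ} {p : Finset ℕ × Finset ℕ} : p ∈ balancedPairs g ↔
    (p.1 ⊆ Finset.range g ∧ p.2 ⊆ Finset.range g) ∧ pairExcess p g = 0 := by
  simp only [balancedPairs, Finset.mem_filter, Finset.mem_product, Finset.mem_powerset]
  refine and_congr_right fun h => ?_
  rw [pairExcess_eq_card_sub_card h.1 h.2, sub_eq_zero, Nat.cast_inj]

/-- Fibering over the common size k gives the sum of the squares of binom(g, k). -/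
theorem card_balancedPairs (g : ℕ) : (balancedPairs g).card = g.centralBinom := by
  rw [Nat.centralBinom, ← Nat.sum_range_choose_sq, Finset.card_eq_sum_card_fiberwise
    (f := fun p => p.1.card) (t := Finset.range (g + 1))]
  · refine Finset.sum_congr rfl fun k _ => ?_
    have : {p ∈ balancedPairs g | p.1.card = k} =
        (Finset.range g).powersetCard k ×ˢ (Finset.range g).powersetCard k := by
      ext p
      simp only [balancedPairs, Finset.mem_filter, Finset.mem_product, Finset.mem_powerset,
        Finset.mem_powersetCard]
      constructor
      · rintro ⟨⟨⟨h1, h2⟩, h3⟩, h4⟩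
        exact ⟨⟨h1, h4⟩, h2, h3 ▸ h4⟩
      · rintro ⟨⟨h1, h2⟩, h3, h4⟩
        exact ⟨⟨⟨h1, h3⟩, h2.trans h4.symm⟩, h2⟩
    rw [this, Finset.card_product, Finset.card_powersetCard, Finset.card_range, sq]
  · intro p hp
    have h := Finset.card_le_card (mem_balancedPairs_iff.1 hp).1.1
    rw [Finset.card_range] at h
    simpa using Nat.lt_succ_of_le h

open Classical in
/-- The openers and closers of a relation in `{0, …, g - 1}`. -/
noncomputable def openerCloserPair (g : ℕ) (s : Setoid ℤ) : Finset ℕ × Finset ℕ :=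
  ({x ∈ Finset.range g | s.IsOpener (x : ℕ)}, {x ∈ Finset.range g | s.IsCloser (x : ℕ)})

theorem mem_openerCloserPair_fst {g x : ℕ} {s : Setoid ℤ} :
    x ∈ (openerCloserPair g s).1 ↔ x < g ∧ s.IsOpener x := by
  simp [openerCloserPair]

theorem mem_openerCloserPair_snd {g x : ℕ} {s : Setoid ℤ} :
    x ∈ (openerCloserPair g s).2 ↔ x < g ∧ s.IsCloser x := by
  simp [openerCloserPair]

section

variable {g : ℕ} {s s' : Setoid ℤ}

theorem pairExcess_openerCloserPair (hg : 0 < g) (hs : s.IsShiftInvariant g)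
    (hn : s.IsIntNoncrossing) {r : ℕ} (hr : r ≤ g) :
    pairExcess (openerCloserPair g s) r = s.height r - s.height 0 := by
  induction r with
  | zero => rw [pairExcess_zero]; simp
  | succ r ih =>
    rw [pairExcess_succ, ih (by omega), Nat.cast_succ,
      Setoid.height_add_one (by exact_mod_cast hg) hs hn]
    simp only [mem_openerCloserPair_fst, mem_openerCloserPair_snd, show r < g by omega, true_and]
    ring

theorem openerCloserPair_mem (hg : 0 < g) (hs : s.IsShiftInvariant g) (hn : s.IsIntNoncrossing) :
    openerCloserPair g s ∈ balancedPairs g := by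
  refine mem_balancedPairs_iff.2
    ⟨⟨fun x hx => Finset.mem_range.2 (mem_openerCloserPair_fst.1 hx).1,
      fun x hx => Finset.mem_range.2 (mem_openerCloserPair_snd.1 hx).1⟩, ?_⟩
  rw [pairExcess_openerCloserPair hg hs hn le_rfl, ← Setoid.height_add_period hs 0, zero_add,
    sub_self]

theorem Setoid.IsShiftInvariant.isOpener_emod (hg : 0 < g) (hs : s.IsShiftInvariant g) (k : ℤ) :
    s.IsOpener k ↔ (k % g).toNat ∈ (openerCloserPair g s).1 := by
  have h1 := Int.emod_nonneg k (show (g : ℤ) ≠ 0 by omega)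
  have h2 := Int.emod_lt_of_pos k (show (0 : ℤ) < g by omega)
  rw [mem_openerCloserPair_fst, Int.toNat_of_nonneg h1, ← (hs.mul (k / g)).isOpener_add (k % g),
    mul_comm, Int.emod_add_mul_ediv, and_iff_right (by omega)]

theorem Setoid.IsShiftInvariant.isCloser_emod (hg : 0 < g) (hs : s.IsShiftInvariant g) (k : ℤ) :
    s.IsCloser k ↔ (k % g).toNat ∈ (openerCloserPair g s).2 := by
  have h1 := Int.emod_nonneg k (show (g : ℤ) ≠ 0 by omega)
  have h2 := Int.emod_lt_of_pos k (show (0 : ℤ) < g by omega)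
  rw [mem_openerCloserPair_snd, Int.toNat_of_nonneg h1, ← (hs.mul (k / g)).isCloser_add (k % g),
    mul_comm, Int.emod_add_mul_ediv, and_iff_right (by omega)]

theorem openerCloserPair_injective (hg : 0 < g) (hs : s.IsShiftInvariant g)
    (hn : s.IsIntNoncrossing) (hs' : s'.IsShiftInvariant g) (hn' : s'.IsIntNoncrossing)
    (h : openerCloserPair g s = openerCloserPair g s') : s = s' := by
  refine Setoid.eq_of_isOpener_iff (by exact_mod_cast hg) hs hn hs' hn' (fun k => ?_) fun k => ?_
  · rw [hs.isOpener_emod hg, hs'.isOpener_emod hg, h]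
  · rw [hs.isCloser_emod hg, hs'.isCloser_emod hg, h]

/-- The excess, extended periodically to ℤ, serves as the height function; balancedness makes it
consistent at the end of a period. It may be negative, since only height differences matter. -/
theorem exists_openerCloserPair_eq (hg : 0 < g) {p : Finset ℕ × Finset ℕ}
    (hp : p ∈ balancedPairs g) : ∃ s : Setoid ℤ, s.IsShiftInvariant g ∧ s.IsIntNoncrossing ∧
      openerCloserPair g s = p := by
  obtain ⟨⟨hp1, hp2⟩, hp0⟩ := mem_balancedPairs_iff.1 hp
  have hg' : (0 : ℤ) < g := by exact_mod_cast hg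
  let A : ℤ → ℤ := fun k => pairExcess p (k % g).toNat
  let L : ℤ → Prop := fun k => (k % g).toNat ∈ p.1
  let R : ℤ → Prop := fun k => (k % g).toNat ∈ p.2
  have hA : ∀ k, A (k + g) = A k := fun k => by simp [A]
  have hL : ∀ k, L (k + g) ↔ L k := fun k => by simp [L]
  have hstep : ∀ k, A (k + 1) = A k + intInd (L k) - intInd (R k) := by
    intro k
    have h1 := Int.emod_nonneg k hg'.ne'
    have h2 := Int.emod_lt_of_pos k hg'
    have h3 : A k + intInd (L k) - intInd (R k) = pairExcess p ((k % g).toNat + 1) := by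
      rw [pairExcess_succ]
      ring
    rw [h3]
    have h4 : (k + 1) % g = (k % g + 1) % g := by rw [Int.emod_add_emod]
    obtain h | h : k % g + 1 < g ∨ k % g + 1 = g := by omega
    · rw [Int.emod_eq_of_lt (by omega) h] at h4
      simp only [A, h4]
      congr 1
      omega
    · rw [h, Int.emod_self] at h4
      simp only [A, h4, show (k % g).toNat + 1 = g by omega, hp0]
      rfl
  refine ⟨heightSetoid (fun k => A k + intInd (L k)) A,
    heightSetoid_isShiftInvariant (fun k => by rw [hA, hL]) hA,
    heightSetoid_isIntNoncrossing fun k => le_add_of_nonneg_right (intInd_nonneg _), ?_⟩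
  have hmod : ∀ x < g, ((x : ℤ) % g).toNat = x := fun x hx => by
    rw [Int.emod_eq_of_lt (by omega) (by omega), Int.toNat_natCast]
  refine Prod.ext (Finset.ext fun x => ?_) (Finset.ext fun x => ?_)
  · rw [mem_openerCloserPair_fst, heightSetoid_isOpener_iff hg' hA hL hstep]
    refine ⟨fun ⟨h1, h2⟩ => ?_, fun h => ?_⟩
    · simpa only [L, hmod x h1] using h2
    · have h1 := Finset.mem_range.1 (hp1 h)
      exact ⟨h1, by simpa only [L, hmod x h1] using h⟩
  · rw [mem_openerCloserPair_snd, heightSetoid_isCloser_iff hg' hA hL hstep]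
    refine ⟨fun ⟨h1, h2⟩ => ?_, fun h => ?_⟩
    · simpa only [R, hmod x h1] using h2
    · have h1 := Finset.mem_range.1 (hp2 h)
      exact ⟨h1, by simpa only [R, hmod x h1] using h⟩

end

/-- Noncrossing equivalence relations on `ℤ` invariant under translation by `g`. -/
abbrev PeriodicNC (g : ℕ) : Type :=
  {s : Setoid ℤ // s.IsShiftInvariant g ∧ s.IsIntNoncrossing}

theorem card_periodicNC {g : ℕ} (hg : 0 < g) : Nat.card (PeriodicNC g) = g.centralBinom := by
  rw [← card_balancedPairs, ← Fintype.card_coe, ← Nat.card_eq_fintype_card]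
  refine Nat.card_eq_of_bijective (fun s : PeriodicNC g =>
    (⟨openerCloserPair g s.1, openerCloserPair_mem hg s.2.1 s.2.2⟩ : balancedPairs g)) ⟨?_, ?_⟩
  · intro s s' h
    exact Subtype.ext (openerCloserPair_injective hg s.2.1 s.2.2 s'.2.1 s'.2.2
      (congrArg Subtype.val h))
  · rintro ⟨p, hp⟩
    obtain ⟨s, hs, hn, h⟩ := exists_openerCloserPair_eq hg hp
    exact ⟨⟨s, hs, hn⟩, Subtype.ext h⟩

/-! ### Relations that do not connect different periods -/

open Classical in
/-- Balanced pairs whose associated lattice path stays nonnegative. -/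
noncomputable def ballotPairs (g : ℕ) : Finset (Finset ℕ × Finset ℕ) :=
  {p ∈ balancedPairs g | ∀ k < g, 1 ≤ pairExcess p k + intInd (k ∈ p.1)}

/-- The ballot condition says that at every point the level is above the height at a multiple of
`g`, so no class can pass over such a multiple. -/
theorem openerCloserPair_mem_ballotPairs_iff {g : ℕ} {s : Setoid ℤ} (hg : 0 < g)
    (hs : s.IsShiftInvariant g) (hn : s.IsIntNoncrossing) :
    openerCloserPair g s ∈ ballotPairs g ↔ ∀ x y, s x y → x / g = y / g := by
  have hg' : (0 : ℤ) < g := by exact_mod_cast hg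
  rw [ballotPairs, Finset.mem_filter, and_iff_right (openerCloserPair_mem hg hs hn)]
  have key : ∀ k < g, pairExcess (openerCloserPair g s) k + intInd (k ∈ (openerCloserPair g s).1) =
      s.height k + intInd (s.IsOpener k) - s.height 0 := by
    intro k hk
    rw [pairExcess_openerCloserPair hg hs hn hk.le, mem_openerCloserPair_fst, and_iff_right hk]
    ring
  constructor
  · intro h
    have hlt : ∀ x y, s x y → x ≤ y → x / g = y / g := by
      intro x y hxy hle
      by_contra hne
      have h1 : x / g < y / g := lt_of_le_of_ne (Int.ediv_le_ediv hg' hle) hne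
      -- The multiple of g at the start of the period of y separates x from y, and has the height of
      -- 0.
      have h2 : x < y / g * g := by rwa [← Int.ediv_lt_iff_lt_mul hg']
      have h3 : y / g * g ≤ y := Int.ediv_mul_le y hg'.ne'
      have h4 := ((Setoid.rel_iff_height hg' hs hn x y).1 hxy).2 (y / g * g) (by omega) (by omega)
      have h5 := Setoid.height_add_period (hs.mul (y / g)) 0
      rw [zero_add] at h5
      have h6 := Setoid.height_add_period (hs.mul (x / g)) (x % g)
      have h7 := (hs.mul (x / g)).isOpener_add (x % g)
      have h8 : x % g + x / g * g = x := by rw [mul_comm, Int.emod_add_mul_ediv]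
      rw [h8] at h6 h7
      have h9 := Int.emod_nonneg x hg'.ne'
      have h10 := Int.emod_lt_of_pos x hg'
      have h11 := h (x % g).toNat (by omega)
      rw [key _ (by omega), Int.toNat_of_nonneg h9, ← h6, ← h7] at h11
      omega
    intro x y hxy
    obtain h1 | h1 := le_total x y
    · exact hlt x y hxy h1
    · exact (hlt y x (s.symm' hxy) h1).symm
  · intro h k hk
    have h0 : s.height 0 = 0 := by
      have : s.openBefore 0 = ∅ := by
        refine Set.eq_empty_of_forall_notMem ?_
        rintro x ⟨-, hx, y, hxy, hy⟩
        have h1 := Int.ediv_neg_of_neg_of_pos hx hg'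
        have h2 := Int.ediv_nonneg hy hg'.le
        have := h x y hxy
        omega
      rw [Setoid.height, this, Set.ncard_empty]
      rfl
    rw [key k hk, h0, sub_zero, ← Setoid.ncard_openAt hg' hs hn]
    obtain ⟨o, hko, ho, -⟩ := s.exists_isOpener (x := k) (b := k / g * g) fun y hy => by
      rw [h _ _ hy]
      exact Int.ediv_mul_le y hg'.ne'
    have : (s.openAt k).Nonempty := ⟨o, ho, ho _ (s.symm' hko), k, s.symm' hko, le_rfl⟩
    have := (Set.ncard_pos (Setoid.openAt_finite hg' hs hn k)).2 this
    omega

theorem card_blockNC {g : ℕ} (hg : 0 < g) : Nat.card {s : PeriodicNC g //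
    ∀ x y, s.1 x y → x / g = y / g} = (ballotPairs g).card := by
  rw [← Fintype.card_coe, ← Nat.card_eq_fintype_card]
  refine Nat.card_eq_of_bijective (fun s : {s : PeriodicNC g // ∀ x y, s.1 x y → x / g = y / g} =>
    (⟨openerCloserPair g s.1.1, (openerCloserPair_mem_ballotPairs_iff hg s.1.2.1 s.1.2.2).2 s.2⟩ :
      ballotPairs g)) ⟨?_, ?_⟩
  · intro s s' h
    exact Subtype.ext (Subtype.ext (openerCloserPair_injective hg s.1.2.1 s.1.2.2 s'.1.2.1 s'.1.2.2
      (congrArg Subtype.val h)))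
  · rintro ⟨p, hp⟩
    obtain ⟨s, hs, hn, rfl⟩ := exists_openerCloserPair_eq hg (Finset.mem_filter.1 hp).1
    exact ⟨⟨⟨s, hs, hn⟩, (openerCloserPair_mem_ballotPairs_iff hg hs hn).1 hp⟩, rfl⟩

/-! ### Ballot pairs and Dyck words -/

/-- The steps of the lattice path associated with a pair of sets. -/
def pairStep (p : Finset ℕ × Finset ℕ) (j : ℕ) : DyckStep :=
  if j % 2 = 0 then if j / 2 ∈ p.1 then .U else .D else if j / 2 ∈ p.2 then .D else .U

theorem pairStep_two_mul (p : Finset ℕ × Finset ℕ) (k : ℕ) :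
    pairStep p (2 * k) = if k ∈ p.1 then .U else .D := by
  simp [pairStep]

theorem pairStep_two_mul_add_one (p : Finset ℕ × Finset ℕ) (k : ℕ) :
    pairStep p (2 * k + 1) = if k ∈ p.2 then .D else .U := by
  simp [pairStep, show (2 * k + 1) % 2 = 1 by omega, show (2 * k + 1) / 2 = k by omega]

/-- The first `n` steps of the lattice path associated with a pair of sets. -/
def pairPath (p : Finset ℕ × Finset ℕ) (n : ℕ) : List DyckStep := (List.range n).map (pairStep p)

theorem length_pairPath (p : Finset ℕ × Finset ℕ) (n : ℕ) : (pairPath p n).length = n := by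
  simp [pairPath]

theorem take_pairPath (p : Finset ℕ × Finset ℕ) (i n : ℕ) :
    (pairPath p n).take i = pairPath p (min i n) := by
  rw [pairPath, ← List.map_take, List.take_range, pairPath]

theorem pairPath_succ (p : Finset ℕ × Finset ℕ) (n : ℕ) :
    pairPath p (n + 1) = pairPath p n ++ [pairStep p n] := by
  simp [pairPath, List.range_succ]

/-- Conditional on the even case, so that the induction for the even case can use it. -/
theorem count_pairPath_two_mul_add_one_of (p : Finset ℕ × Finset ℕ) (k : ℕ)
    (h : ((pairPath p (2 * k)).count .U : ℤ) - (pairPath p (2 * k)).count .D = 2 * pairExcess p k) :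
    ((pairPath p (2 * k + 1)).count .U : ℤ) - (pairPath p (2 * k + 1)).count .D =
      2 * (pairExcess p k + intInd (k ∈ p.1)) - 1 := by
  rw [pairPath_succ, List.count_append, List.count_append, pairStep_two_mul]
  by_cases hk : k ∈ p.1
  · rw [intInd_of hk, if_pos hk]
    simp
    omega
  · rw [intInd_of_not hk, if_neg hk]
    simp
    omega

theorem count_pairPath_two_mul (p : Finset ℕ × Finset ℕ) (k : ℕ) :
    ((pairPath p (2 * k)).count .U : ℤ) - (pairPath p (2 * k)).count .D = 2 * pairExcess p k := by
  induction k with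
  | zero => rfl
  | succ k ih =>
    have h := count_pairPath_two_mul_add_one_of p k ih
    rw [show 2 * (k + 1) = 2 * k + 1 + 1 by ring, pairPath_succ, List.count_append,
      List.count_append, pairStep_two_mul_add_one, pairExcess_succ]
    by_cases hk : k ∈ p.2
    · rw [intInd_of hk, if_pos hk]
      simp
      omega
    · rw [intInd_of_not hk, if_neg hk]
      simp
      omega

theorem count_pairPath_two_mul_add_one (p : Finset ℕ × Finset ℕ) (k : ℕ) :
    ((pairPath p (2 * k + 1)).count .U : ℤ) - (pairPath p (2 * k + 1)).count .D =
      2 * (pairExcess p k + intInd (k ∈ p.1)) - 1 :=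
  count_pairPath_two_mul_add_one_of p k (count_pairPath_two_mul p k)

/-- The ballot condition h ≥ 1 is nonnegativity at odd times, where the path is at height 2h - 1. At
even times the height is even and one step away, so nonnegativity follows. -/
theorem count_pairPath_le {g : ℕ} {p : Finset ℕ × Finset ℕ} (hp : p ∈ ballotPairs g) {i : ℕ}
    (hi : i ≤ 2 * g) : (pairPath p i).count .D ≤ (pairPath p i).count .U := by
  have hb := (Finset.mem_filter.1 hp).2
  obtain ⟨k, rfl | rfl⟩ := Nat.even_or_odd' i
  · have h := count_pairPath_two_mul p k
    obtain _ | k := k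
    · rfl
    · have h1 := hb k (by omega)
      have h2 := intInd_le_one (k ∈ p.2)
      rw [pairExcess_succ] at h
      omega
  · have h := count_pairPath_two_mul_add_one p k
    have h1 := hb k (by omega)
    omega

/-- The Dyck word associated with a ballot pair. -/
def ballotPairToDyckWord {g : ℕ} (p : ballotPairs g) : {w : DyckWord // w.semilength = g} :=
  have h : (pairPath p.1 (2 * g)).count .U = (pairPath p.1 (2 * g)).count .D := by
    have h1 := count_pairPath_two_mul p.1 g
    rw [(mem_balancedPairs_iff.1 (Finset.mem_filter.1 p.2).1).2] at h1
    omega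
  ⟨⟨pairPath p.1 (2 * g), h, fun i => by
    rw [take_pairPath]
    exact count_pairPath_le p.2 (by omega)⟩, by
    have := DyckWord.two_mul_semilength_eq_length (p := ⟨pairPath p.1 (2 * g), h, fun i => by
      rw [take_pairPath]
      exact count_pairPath_le p.2 (by omega)⟩)
    rw [length_pairPath] at this
    omega⟩

theorem ballotPairToDyckWord_bijective (g : ℕ) :
    Function.Bijective (ballotPairToDyckWord (g := g)) := by
  constructor
  · rintro ⟨p, hp⟩ ⟨p', hp'⟩ h
    have hpath : pairPath p (2 * g) = pairPath p' (2 * g) := congrArg (fun w => w.1.toList) h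
    have hstep : ∀ j < 2 * g, pairStep p j = pairStep p' j := by
      simpa [pairPath, List.map_inj_left] using hpath
    have hs := (mem_balancedPairs_iff.1 (Finset.mem_filter.1 hp).1).1
    have hs' := (mem_balancedPairs_iff.1 (Finset.mem_filter.1 hp').1).1
    refine Subtype.ext (Prod.ext (Finset.ext fun k => ?_) (Finset.ext fun k => ?_))
    · by_cases hk : k < g
      · have h1 := hstep (2 * k) (by omega)
        rw [pairStep_two_mul, pairStep_two_mul] at h1
        by_cases h2 : k ∈ p.1 <;> by_cases h3 : k ∈ p'.1 <;> simp_all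
      · exact iff_of_false (fun h => hk (Finset.mem_range.1 (hs.1 h)))
          fun h => hk (Finset.mem_range.1 (hs'.1 h))
    · by_cases hk : k < g
      · have h1 := hstep (2 * k + 1) (by omega)
        rw [pairStep_two_mul_add_one, pairStep_two_mul_add_one] at h1
        by_cases h2 : k ∈ p.2 <;> by_cases h3 : k ∈ p'.2 <;> simp_all
      · exact iff_of_false (fun h => hk (Finset.mem_range.1 (hs.2 h)))
          fun h => hk (Finset.mem_range.1 (hs'.2 h))
  · rintro ⟨w, hw⟩
    have hlen := w.two_mul_semilength_eq_length
    rw [hw] at hlen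
    let p : Finset ℕ × Finset ℕ := ({k ∈ Finset.range g | w.toList[2 * k]? = some .U},
      {k ∈ Finset.range g | w.toList[2 * k + 1]? = some .D})
    have hpath : pairPath p (2 * g) = w.toList := by
      refine List.ext_getElem (by rw [length_pairPath, hlen]) fun j h1 h2 => ?_
      have hj : j < 2 * g := by omega
      simp only [pairPath, List.getElem_map, List.getElem_range]
      obtain ⟨k, rfl | rfl⟩ := Nat.even_or_odd' j
      · rw [pairStep_two_mul]
        rcases (w.toList[2 * k]).dichotomy with h | h <;>
          simp [p, h, List.getElem?_eq_getElem h2]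
        omega
      · rw [pairStep_two_mul_add_one]
        rcases (w.toList[2 * k + 1]).dichotomy with h | h <;>
          simp [p, h, List.getElem?_eq_getElem h2]
        omega
    have hp : p ∈ ballotPairs g := by
      refine Finset.mem_filter.2 ⟨mem_balancedPairs_iff.2
        ⟨⟨Finset.filter_subset _ _, Finset.filter_subset _ _⟩, ?_⟩, fun k hk => ?_⟩
      · have h := count_pairPath_two_mul p g
        rw [hpath, w.count_U_eq_count_D] at h
        omega
      · have h := count_pairPath_two_mul_add_one p k
        have h1 := w.count_D_le_count_U (2 * k + 1)
        rw [← hpath, take_pairPath, min_eq_left (by omega)] at h1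
        omega
    exact ⟨⟨p, hp⟩, Subtype.ext (DyckWord.ext hpath)⟩

theorem card_ballotPairs (g : ℕ) : (ballotPairs g).card = catalan g := by
  rw [← DyckWord.card_dyckWord_semilength_eq_catalan, ← Fintype.card_coe, ← Nat.card_eq_fintype_card,
    ← Nat.card_eq_fintype_card]
  exact Nat.card_eq_of_bijective _ (ballotPairToDyckWord_bijective g)

/-! ### Relations on `ℤ` that are pulled back from a cycle -/

/-- Equivalence relations on `ℤ` that are pulled back from a noncrossing relation on the `n`-cycle. -/
def Setoid.IsCyclicNC (s : Setoid ℤ) (n : ℤ) : Prop :=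
  (∀ x, s x (x + n)) ∧
    ∀ a b c d, a < b → b < c → c < d → d < a + n → s a c → s b d → s a b

namespace Setoid

variable {s : Setoid ℤ} {g n : ℤ}

theorem IsShiftInvariant.rel_add_mul (hs : s.IsShiftInvariant g) {x : ℤ} (h : s x (x + g)) (k : ℤ) :
    s x (x + k * g) := by
  induction k using Int.induction_on with
  | zero => simp
  | succ k ih =>
    refine s.trans' h ?_
    rw [show x + ((k : ℤ) + 1) * g = x + k * g + g by ring, hs]
    exact ih
  | pred k ih =>
    refine s.trans' ih ?_
    rw [← hs, show x + (-(k : ℤ) - 1) * g + g = x + -k * g by ring]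
    exact s.symm' (s.trans' (s.symm' ih) (s.trans' h ((hs _ _).2 ih)))

theorem IsCyclicNC.rel_add_mul (hc : s.IsCyclicNC n) (x k : ℤ) : s x (x + k * n) := by
  refine IsShiftInvariant.rel_add_mul (fun x y => ?_) (hc.1 x) k
  exact ⟨fun h => s.trans' (hc.1 x) (s.trans' h (s.symm' (hc.1 y))),
    fun h => s.trans' (s.symm' (hc.1 x)) (s.trans' h (hc.1 y))⟩

theorem IsCyclicNC.isShiftInvariant (hc : s.IsCyclicNC n) : s.IsShiftInvariant n := fun x y =>
  ⟨fun h => s.trans' (hc.1 x) (s.trans' h (s.symm' (hc.1 y))),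
    fun h => s.trans' (s.symm' (hc.1 x)) (s.trans' h (hc.1 y))⟩

theorem IsShiftInvariant.rel_add_of_rel (hs : s.IsShiftInvariant g) {x y : ℤ} (h : s x y)
    (hx : s x (x + g)) : s y (y + g) :=
  s.trans' (s.symm' h) (s.trans' hx ((hs x y).2 h))

/-- The pair x, y and its translate by `g` would otherwise cross within a window of length `n`. -/
theorem IsCyclicNC.rel_add_of_add_lt (hc : s.IsCyclicNC n) (hs : s.IsShiftInvariant g)
    (hg : 0 < g) {x y : ℤ} (h : s x y) (h1 : x + g < y) (h2 : y + g < x + n) : s x (x + g) :=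
  hc.2 x (x + g) y (y + g) (by omega) h1 (by omega) h2 h ((hs x y).2 h)

/-! ### Cutting classes into short pieces -/

/-- The relation `s`, with the classes that are not invariant under translation by `g` cut into
pieces of diameter less than `g`. -/
def shortRel (s : Setoid ℤ) (hc : s.IsCyclicNC n) (hs : s.IsShiftInvariant g) (hg : 0 < g)
    (hgn : 2 * g ≤ n) : Setoid ℤ where
  r x y := s x y ∧ (s x (x + g) ∨ x < y + g ∧ y < x + g)
  iseqv := by
    -- Transitivity can only fail if two short steps make a long one. Then y < x + g < z < y + g, up
    -- to equality x + g = z, and noncrossing makes the class invariant.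
    have key : ∀ x y z, x ≤ y → y ≤ z → s x y → s y z → y < x + g → z < y + g → x + g ≤ z →
        s x (x + g) := by
      intro x y z hxy hyz h1 h2 h3 h4 h5
      obtain rfl | h5 := h5.eq_or_lt
      · exact s.trans' h1 h2
      · exact hs.rel_add_of_rel (s.symm' h1) (s.trans' (hc.2 y (x + g) z (y + g) h3 h5 h4
          (by omega) h2 ((hs x y).2 h1)) ((hs x y).2 h1))
    refine ⟨fun x => ⟨s.refl' x, Or.inr ⟨by omega, by omega⟩⟩, fun {x y} ⟨h1, h2⟩ =>
      ⟨s.symm' h1, h2.imp (hs.rel_add_of_rel h1) And.symm⟩, fun {x y z} ⟨h1, h2⟩ ⟨h3, h4⟩ =>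
      ⟨s.trans' h1 h3, ?_⟩⟩
    obtain h2 | h2 := h2
    · exact Or.inl h2
    obtain h4 | h4 := h4
    · exact Or.inl (hs.rel_add_of_rel (s.symm' h1) h4)
    by_cases h5 : x < z + g ∧ z < x + g
    · exact Or.inr h5
    · left
      obtain h6 | h6 : x + g ≤ z ∨ z + g ≤ x := by omega
      · exact key x y z (by omega) (by omega) h1 h3 h2.2 h4.2 h6
      · exact hs.rel_add_of_rel (s.symm' (s.trans' h1 h3)) (key z y x (by omega) (by omega)
          (s.symm' h3) (s.symm' h1) h4.1 h2.1 h6)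

section shortRel

variable (hc : s.IsCyclicNC n) (hs : s.IsShiftInvariant g) (hg : 0 < g) (hgn : 2 * g ≤ n)

theorem shortRel_apply (x y : ℤ) : s.shortRel hc hs hg hgn x y ↔
    s x y ∧ (s x (x + g) ∨ x < y + g ∧ y < x + g) := Iff.rfl

theorem shortRel_isShiftInvariant : (s.shortRel hc hs hg hgn).IsShiftInvariant g := by
  intro x y
  rw [shortRel_apply, shortRel_apply, hs, hs]
  exact and_congr_right fun _ => or_congr_right (by omega)

/-- A point of an invariant class may be moved by multiples of `g`. In each case this brings a
suitable quadruple into a window of length less than 2g ≤ n, where the cyclic condition applies. -/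
theorem shortRel_isIntNoncrossing : (s.shortRel hc hs hg hgn).IsIntNoncrossing := by
  intro a b c d hab hbc hcd ⟨hac, hac'⟩ ⟨hbd, hbd'⟩
  rw [shortRel_apply]
  obtain ha | ha := hac' <;> obtain hb | hb := hbd'
  · refine ⟨?_, Or.inl ha⟩
    have h1 := Int.emod_nonneg (b - a - 1) hg.ne'
    have h2 := Int.emod_lt_of_pos (b - a - 1) hg
    have h3 := Int.emod_add_mul_ediv (b - a - 1) g
    have h4 := hs.rel_add_mul hb (-((b - a - 1) / g))
    obtain ⟨b', hb'⟩ : ∃ b', b' = b + -((b - a - 1) / g) * g := ⟨_, rfl⟩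
    have h5 : b' = a + 1 + (b - a - 1) % g := by rw [hb']; linarith
    rw [← hb'] at h4
    obtain h6 | h6 : b' = a + g ∨ b' < a + g := by omega
    · rw [h6] at h4
      exact s.trans' ha (s.symm' h4)
    · exact s.trans' (hc.2 a b' (a + g) (b' + g) (by omega) h6 (by omega) (by omega) ha
        (hs.rel_add_of_rel h4 hb)) (s.symm' h4)
  · refine ⟨?_, Or.inl ha⟩
    have h1 := Int.emod_nonneg (b - 1 - a) hg.ne'
    have h2 := Int.emod_lt_of_pos (b - 1 - a) hg
    have h3 := Int.emod_add_mul_ediv (b - 1 - a) g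
    have h4 := hs.rel_add_mul ha ((b - 1 - a) / g)
    obtain ⟨a', ha'⟩ : ∃ a', a' = a + (b - 1 - a) / g * g := ⟨_, rfl⟩
    have h5 : a' = b - 1 - (b - 1 - a) % g := by rw [ha']; linarith
    rw [← ha'] at h4
    exact s.trans' h4 (hc.2 a' b c d (by omega) hbc hcd (by omega)
      (s.trans' (s.symm' h4) hac) hbd)
  · refine ⟨?_, Or.inr ⟨by omega, by omega⟩⟩
    have h1 := Int.emod_nonneg (d - c - 1) hg.ne'
    have h2 := Int.emod_lt_of_pos (d - c - 1) hg
    have h3 := Int.emod_add_mul_ediv (d - c - 1) g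
    have h4 := hs.rel_add_mul (hs.rel_add_of_rel hbd hb) (-((d - c - 1) / g))
    obtain ⟨d', hd'⟩ : ∃ d', d' = d + -((d - c - 1) / g) * g := ⟨_, rfl⟩
    have h5 : d' = c + 1 + (d - c - 1) % g := by rw [hd']; linarith
    rw [← hd'] at h4
    exact hc.2 a b c d' hab hbc (by omega) (by omega) hac (s.trans' hbd h4)
  · exact ⟨hc.2 a b c d hab hbc hcd (by omega) hac hbd, Or.inr ⟨by omega, by omega⟩⟩

/-- The original relation is recovered from its short version. -/
theorem rel_iff_exists_shortRel (x y : ℤ) :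
    s x y ↔ ∃ k, s.shortRel hc hs hg hgn x (y + k * n) := by
  simp only [shortRel_apply]
  constructor
  · intro h
    by_cases hx : s x (x + g)
    · exact ⟨0, by simpa using h, Or.inl hx⟩
    have hn : 0 < n := by omega
    have h1 := Int.emod_nonneg (y - x) hn.ne'
    have h2 := Int.emod_lt_of_pos (y - x) hn
    have h3 := Int.emod_add_mul_ediv (y - x) n
    have h4 : s x (y + -((y - x) / n) * n) := s.trans' h (hc.rel_add_mul y _)
    have h4' : s x (y + (-((y - x) / n) - 1) * n) := s.trans' h (hc.rel_add_mul y _)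
    have h5 : y + -((y - x) / n) * n = x + (y - x) % n := by linarith
    have h6 : y + (-((y - x) / n) - 1) * n = x + (y - x) % n - n := by linarith
    by_cases h7 : (y - x) % n < g
    · exact ⟨_, h4, Or.inr ⟨by omega, by omega⟩⟩
    by_cases h8 : n < (y - x) % n + g
    · exact ⟨_, h4', Or.inr ⟨by omega, by omega⟩⟩
    -- Now the residue r of y - x satisfies g ≤ r ≤ n - g. Then x and y cross their translates by g,
    -- or one of the boundary equalities holds; either way the class is invariant.
    refine absurd ?_ hx
    rw [h5] at h4
    obtain h9 | h9 : (y - x) % n = g ∨ g < (y - x) % n := by omega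
    · rwa [h9] at h4
    obtain h10 | h10 : (y - x) % n + g = n ∨ (y - x) % n + g < n := by omega
    · refine hs.rel_add_of_rel (s.symm' h4) ?_
      rw [add_assoc, h10]
      exact s.trans' (s.symm' h4) (hc.1 x)
    · exact hc.rel_add_of_add_lt hs hg h4 (by omega) (by omega)
  · rintro ⟨k, hk, -⟩
    exact s.trans' hk (s.symm' (hc.rel_add_mul y k))

end shortRel

theorem IsShiftInvariant.rel_add_of_add_le_or (hs : s.IsShiftInvariant g)
    (hn : s.IsIntNoncrossing) (hg : 0 < g) {x y : ℤ} (h : s x y) (hxy : x + g ≤ y ∨ y + g ≤ x) :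
    s x (x + g) := by
  obtain h1 | h1 := hxy
  · exact rel_add_of_add_le hg hs hn h h1
  · exact hs.rel_add_of_rel (s.symm' h) (rel_add_of_add_le hg hs hn (s.symm' h) h1)

/-! ### Reduction modulo n as the inverse of cutting -/

/-- The relation on `ℤ` obtained from `s` by identifying numbers that are congruent modulo `n`. -/
def modRel (s : Setoid ℤ) (n : ℤ) (hs : s.IsShiftInvariant n) : Setoid ℤ where
  r x y := ∃ k, s x (y + k * n)
  iseqv := by
    refine ⟨fun x => ⟨0, by simp⟩, fun {x y} ⟨k, h⟩ => ⟨-k, ?_⟩,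
      fun {x y z} ⟨k, h⟩ ⟨l, h'⟩ => ⟨k + l, ?_⟩⟩
    · rw [← hs.mul k, neg_mul, neg_add_cancel_right]
      exact s.symm' h
    · rw [add_comm k, add_mul, ← add_assoc]
      exact s.trans' h ((hs.mul k _ _).2 h')

section modRel

variable {m : ℤ} (hs : s.IsShiftInvariant g) (hn : s.IsIntNoncrossing) (hg : 0 < g) (hm : 2 ≤ m)

include hs hn hg hm in
-- For any shift other than 0 or -1, the two related points are at least `g` apart, so their class
-- is invariant under `g` and the shift can be undone.
theorem rel_or_of_modRel {a c k : ℤ} (hac : a < c) (hcn : c < a + m * g)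
    (h : s a (c + k * (m * g))) : s a c ∨ s a (c - m * g) := by
  have hmg : 2 * g ≤ m * g := by gcongr
  obtain rfl | rfl | hk : k = 0 ∨ k = -1 ∨ (1 ≤ k ∨ k ≤ -2) := by omega
  · left; simpa using h
  · right; simpa [sub_eq_add_neg] using h
  · left
    have h1 : s a (a + g) := by
      refine hs.rel_add_of_add_le_or hn hg h ?_
      obtain hk | hk := hk
      · left
        have : 1 * (m * g) ≤ k * (m * g) := by gcongr
        omega
      · right
        have : k * (m * g) ≤ -2 * (m * g) := by gcongr
        omega
    have h2 := hs.rel_add_mul (hs.rel_add_of_rel h h1) (-(k * m))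
    rw [show c + k * (m * g) + -(k * m) * g = c by ring] at h2
    exact s.trans' h h2

include hn hg hm in
theorem modRel_isCyclicNC : (s.modRel (m * g) (hs.mul m)).IsCyclicNC (m * g) := by
  have hmg : 2 * g ≤ m * g := by gcongr
  have hs' := hs.mul m
  have hself : ∀ {x y}, s x y → s.modRel (m * g) (hs.mul m) x y := fun h => ⟨0, by simpa using h⟩
  have hadd : ∀ x, s.modRel (m * g) (hs.mul m) x (x + m * g) := fun x =>
    ⟨-1, by simp⟩
  have key : ∀ a b c d, a < b → b < c → c < d → d < a + m * g → s a c →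
      s.modRel (m * g) (hs.mul m) b d → s a b := by
    rintro a b c d hab hbc hcd hda hac ⟨k, hbd⟩
    obtain h | h := rel_or_of_modRel hs hn hg hm (by omega) (by omega) hbd
    · exact hn a b c d hab hbc hcd hac h
    · have h1 := hn (d - m * g) a b c (by omega) hab hbc (s.symm' h) hac
      exact s.trans' (s.symm' h1) (s.symm' h)
  refine ⟨hadd, ?_⟩
  intro a b c d hab hbc hcd hda ⟨k, hac⟩ hbd
  obtain h | h := rel_or_of_modRel hs hn hg hm (by omega) (by omega) hac
  · exact hself (key a b c d hab hbc hcd hda h hbd)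
  · have h1 : s c (a + m * g) := by
      rw [← hs', sub_add_cancel] at h
      exact s.symm' h
    have h2 := hself (key c d (a + m * g) (b + m * g) hcd hda (by omega) (by omega) h1
      (Setoid.trans' _ (Setoid.symm' _ hbd) (hadd b)))
    exact Setoid.trans' _ ⟨k, hac⟩ (Setoid.trans' _ h2 (Setoid.symm' _ hbd))

theorem IsShiftInvariant.modRel {n : ℤ} (hs : s.IsShiftInvariant g) (hn : s.IsShiftInvariant n) :
    (s.modRel n hn).IsShiftInvariant g := by
  intro x y
  refine exists_congr fun k => ?_
  rw [add_right_comm, hs]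

include hn in
/-- Passing to congruences and cutting into short pieces recovers the relation. -/
theorem shortRel_modRel (hmg : 2 * g ≤ m * g) :
    (s.modRel (m * g) (hs.mul m)).shortRel (modRel_isCyclicNC hs hn hg hm) (hs.modRel (hs.mul m))
      hg hmg = s := by
  have hZ : ∀ x, s.modRel (m * g) (hs.mul m) x (x + g) → s x (x + g) := by
    rintro x ⟨k, hk⟩
    refine hs.rel_add_of_add_le_or hn hg hk ?_
    obtain hk0 | hk0 : 0 ≤ k ∨ k ≤ -1 := by omega
    · left
      have : 0 ≤ k * (m * g) := mul_nonneg hk0 (by omega)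
      omega
    · right
      have : k * (m * g) ≤ -1 * (m * g) := mul_le_mul_of_nonneg_right hk0 (by omega)
      omega
  ext x y
  rw [shortRel_apply]
  constructor
  · rintro ⟨⟨k, hk⟩, h⟩
    have h1 : s x (x + g) → s x y := by
      intro h2
      have h3 := hs.rel_add_mul (hs.rel_add_of_rel hk h2) (-(k * m))
      rw [show y + k * (m * g) + -(k * m) * g = y by ring] at h3
      exact s.trans' hk h3
    obtain h | h := h
    · exact h1 (hZ x h)
    · obtain rfl | hk0 | hk0 : k = 0 ∨ 1 ≤ k ∨ k ≤ -1 := by omega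
      · simpa using hk
      · have : 1 * (m * g) ≤ k * (m * g) := mul_le_mul_of_nonneg_right hk0 (by omega)
        exact h1 (hs.rel_add_of_add_le_or hn hg hk (by omega))
      · have : k * (m * g) ≤ -1 * (m * g) := mul_le_mul_of_nonneg_right hk0 (by omega)
        exact h1 (hs.rel_add_of_add_le_or hn hg hk (by omega))
  · intro h
    refine ⟨⟨0, by simpa using h⟩, ?_⟩
    by_cases h1 : x < y + g ∧ y < x + g
    · exact Or.inr h1
    · exact Or.inl ⟨0, by simpa using hs.rel_add_of_add_le_or hn hg h (by omega)⟩

end modRel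

end Setoid

/-! ### Set partitions as relations on `ℤ` -/

theorem Finpartition.eq_of_part_eq_iff {α : Type*} [Fintype α] [DecidableEq α]
    {P Q : Finpartition (Finset.univ : Finset α)}
    (h : ∀ a b, P.part a = P.part b ↔ Q.part a = Q.part b) : P = Q := by
  have key : ∀ P Q : Finpartition (Finset.univ : Finset α),
      (∀ a b, P.part a = P.part b ↔ Q.part a = Q.part b) → P.parts ⊆ Q.parts := by
    intro P Q h B hB
    obtain ⟨a, ha⟩ := P.nonempty_of_mem_parts hB
    rw [← P.part_eq_of_mem hB ha]
    have : P.part a = Q.part a := by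
      ext b
      rw [P.mem_part_iff_part_eq_part (Finset.mem_univ _) (Finset.mem_univ _), h,
        ← Q.mem_part_iff_part_eq_part (Finset.mem_univ _) (Finset.mem_univ _)]
    rw [this]
    exact Q.part_mem.2 (Finset.mem_univ a)
  exact Finpartition.ext (Finset.Subset.antisymm (key P Q h) (key Q P fun a b => (h a b).symm))

namespace SetPartition

variable {n : ℕ}

theorem isNoncrossing_iff_part {π : SetPartition n} : π.IsNoncrossing ↔
    ∀ a b c d : Fin n, a < b → b < c → c < d → π.part a = π.part c → π.part b = π.part d →
      π.part a = π.part b := by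
  have hmem : ∀ a : Fin n, a ∈ π.part a := fun a => π.mem_part_self.2 (Finset.mem_univ a)
  have hpart : ∀ a : Fin n, π.part a ∈ π.parts := fun a => π.part_mem.2 (Finset.mem_univ a)
  constructor
  · intro h a b c d hab hbc hcd hac hbd
    exact h a b c d hab hbc hcd _ (hpart a) _ (hpart b) (hmem a) (hac ▸ hmem c) (hmem b)
      (hbd ▸ hmem d)
  · intro h a b c d hab hbc hcd B hB B' hB' ha hc hb hd
    rw [← π.part_eq_of_mem hB ha, ← π.part_eq_of_mem hB' hb]
    refine h a b c d hab hbc hcd ?_ ?_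
    · rw [π.part_eq_of_mem hB ha, π.part_eq_of_mem hB hc]
    · rw [π.part_eq_of_mem hB' hb, π.part_eq_of_mem hB' hd]

theorem part_smul (w : Equiv.Perm (Fin n)) (π : SetPartition n) (a : Fin n) :
    (w • π).part (w a) = (π.part a).image w := by
  apply Finpartition.part_eq_of_mem
  · rw [parts_smul]
    exact Finset.mem_image_of_mem _ (π.part_mem.2 (Finset.mem_univ a))
  · exact Finset.mem_image_of_mem _ (π.mem_part_self.2 (Finset.mem_univ a))

theorem part_smul_eq_iff (w : Equiv.Perm (Fin n)) (π : SetPartition n) (a b : Fin n) :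
    (w • π).part (w a) = (w • π).part (w b) ↔ π.part a = π.part b := by
  rw [part_smul, part_smul, (Finset.image_injective w.injective).eq_iff]

/-- The residue of an integer modulo `n`. -/
def residue [NeZero n] (x : ℤ) : Fin n :=
  ⟨(x % n).toNat, by
    have := Int.emod_lt_of_pos x (show (0 : ℤ) < n by exact_mod_cast NeZero.pos n)
    have := NeZero.pos n
    omega⟩

theorem coe_residue [NeZero n] (x : ℤ) : ((residue x : Fin n) : ℤ) = x % n :=
  Int.toNat_of_nonneg (Int.emod_nonneg x (by exact_mod_cast NeZero.ne n))

theorem residue_eq_iff [NeZero n] {x y : ℤ} : (residue x : Fin n) = residue y ↔ x % n = y % n := by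
  rw [← coe_residue, ← coe_residue, Fin.ext_iff, Nat.cast_inj]

theorem residue_coe [NeZero n] (a : Fin n) : residue (a : ℤ) = a := by
  rw [Fin.ext_iff, ← Nat.cast_inj (R := ℤ), coe_residue]
  exact Int.emod_eq_of_lt (by omega) (by omega)

theorem finRotate_residue [NeZero n] (x : ℤ) : finRotate n (residue x) = residue (x + 1) := by
  obtain ⟨m, rfl⟩ : ∃ m, n = m + 1 := ⟨n - 1, by have := NeZero.pos n; omega⟩
  have h1 := coe_residue (n := m + 1) x
  have h2 := Int.emod_lt_of_pos x (show (0 : ℤ) < (m + 1 : ℕ) by omega)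
  have h3 : (x + 1) % (m + 1 : ℕ) = (x % (m + 1 : ℕ) + 1) % (m + 1 : ℕ) := by rw [Int.emod_add_emod]
  rw [Fin.ext_iff, ← Nat.cast_inj (R := ℤ), coe_residue, coe_finRotate, h3, ← h1]
  split_ifs with h
  · rw [h, Fin.val_last]
    push_cast
    rw [Int.emod_self]
  · have h4 : ((residue x : Fin (m + 1)) : ℕ) ≠ m := fun h' => h (Fin.ext (by simpa using h'))
    rw [Int.emod_eq_of_lt (by omega) (by omega)]
    push_cast
    rfl

theorem finRotate_pow_residue [NeZero n] (d : ℕ) (x : ℤ) :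
    (finRotate n ^ d) (residue x) = residue (x + d) := by
  induction d with
  | zero => simp
  | succ d ih =>
    rw [pow_succ', Equiv.Perm.mul_apply, ih, finRotate_residue, Nat.cast_succ, add_assoc]

/-- The pullback of a set partition to `ℤ`. -/
def cyclicRel [NeZero n] (π : SetPartition n) : Setoid ℤ :=
  Setoid.ker fun x => π.part (residue x)

theorem cyclicRel_apply [NeZero n] (π : SetPartition n) (x y : ℤ) :
    π.cyclicRel x y ↔ π.part (residue x) = π.part (residue y) := Iff.rfl

theorem cyclicRel_injective [NeZero n] :
    Function.Injective (cyclicRel : SetPartition n → Setoid ℤ) := by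
  intro π π' h
  refine Finpartition.eq_of_part_eq_iff fun a b => ?_
  have := cyclicRel_apply π a b
  rwa [h, cyclicRel_apply, residue_coe, residue_coe, iff_comm] at this

theorem cyclicRel_smul_add [NeZero n] (π : SetPartition n) (d : ℕ) (x y : ℤ) :
    (finRotate n ^ d • π).cyclicRel (x + d) (y + d) ↔ π.cyclicRel x y := by
  rw [cyclicRel_apply, ← finRotate_pow_residue, ← finRotate_pow_residue, part_smul_eq_iff,
    cyclicRel_apply]

theorem finRotate_pow_smul_eq_iff [NeZero n] (π : SetPartition n) (d : ℕ) :
    finRotate n ^ d • π = π ↔ π.cyclicRel.IsShiftInvariant d := by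
  constructor
  · intro h x y
    conv_lhs => rw [← h]
    exact cyclicRel_smul_add π d x y
  · intro h
    apply cyclicRel_injective
    ext x y
    have h1 := cyclicRel_smul_add π d (x - d) (y - d)
    have h2 := h (x - d) (y - d)
    rw [sub_add_cancel, sub_add_cancel] at h1 h2
    rw [h1, h2]

theorem rel_of_isNoncrossing [NeZero n] {π : SetPartition n} (hπ : π.IsNoncrossing) {a b c d : ℤ}
    (ha : 0 ≤ a) (hab : a < b) (hbc : b < c) (hcd : c < d) (hd : d < n) (hac : π.cyclicRel a c)
    (hbd : π.cyclicRel b d) : π.cyclicRel a b := by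
  have hlt : ∀ x y : ℤ, 0 ≤ x → x < y → y < n → (residue x : Fin n) < residue y := by
    intro x y hx hxy hy
    rw [Fin.lt_def, ← Nat.cast_lt (α := ℤ), coe_residue, coe_residue,
      Int.emod_eq_of_lt hx (by omega), Int.emod_eq_of_lt (by omega) hy]
    exact hxy
  exact isNoncrossing_iff_part.1 hπ _ _ _ _ (hlt a b ha hab (by omega))
    (hlt b c (by omega) hbc (by omega)) (hlt c d (by omega) hcd hd) hac hbd

theorem cyclicRel_add [NeZero n] (π : SetPartition n) (x : ℤ) : π.cyclicRel x (x + n) := by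
  rw [cyclicRel_apply]
  congr 1
  rw [residue_eq_iff, Int.add_emod_right]

theorem IsNoncrossing.isCyclicNC [NeZero n] {π : SetPartition n} (hπ : π.IsNoncrossing) :
    π.cyclicRel.IsCyclicNC n := by
  refine ⟨cyclicRel_add π, ?_⟩
  have hn : (0 : ℤ) < n := by exact_mod_cast NeZero.pos n
  have hsub : ∀ x, π.cyclicRel x (x - n) := fun x => by
    simpa using Setoid.symm' _ (cyclicRel_add π (x - n))
  -- The points at or beyond n are moved back by n. The result is a cyclic reordering of the four
  -- points inside [0, n), one case for each number of points moved.
  have key : ∀ a b c d : ℤ, 0 ≤ a → a < n → a < b → b < c → c < d → d < a + n →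
      π.cyclicRel a c → π.cyclicRel b d → π.cyclicRel a b := by
    intro a b c d ha han hab hbc hcd hda hac hbd
    have hc := hac.trans (hsub c)
    have hd := hbd.trans (hsub d)
    have hb := (hsub b).symm.trans hbd
    have hb' := (hsub b).symm.trans hd
    by_cases h1 : d < n
    · exact rel_of_isNoncrossing hπ ha hab hbc hcd h1 hac hbd
    by_cases h2 : c < n
    · have := rel_of_isNoncrossing hπ (show 0 ≤ d - n by omega) (by omega) hab hbc h2
        (Setoid.symm' _ hd) hac
      exact Setoid.symm' _ (Setoid.trans' _ hd this)
    by_cases h3 : b < n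
    · have := rel_of_isNoncrossing hπ (show 0 ≤ c - n by omega) (by omega) (by omega) hab h3
        (Setoid.symm' _ hc) (Setoid.symm' _ hd)
      exact Setoid.trans' _ hc (Setoid.trans' _ this (Setoid.symm' _ hd))
    · have := rel_of_isNoncrossing hπ (show 0 ≤ b - n by omega) (show b - n < c - n by omega)
        (show c - n < d - n by omega) (by omega) han hb' (Setoid.symm' _ hc)
      exact Setoid.trans' _ hc (Setoid.symm' _ (Setoid.trans' _ (hsub b) this))
  intro a b c d hab hbc hcd hda hac hbd
  have hinv : π.cyclicRel.IsShiftInvariant n := fun x y =>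
    ⟨fun h => Setoid.trans' _ (cyclicRel_add π x) (Setoid.trans' _ h
      (Setoid.symm' _ (cyclicRel_add π y))),
    fun h => Setoid.trans' _ (Setoid.symm' _ (cyclicRel_add π x)) (Setoid.trans' _ h
      (cyclicRel_add π y))⟩
  have hinv' := hinv.mul (-(a / n))
  have h1 := Int.emod_nonneg a hn.ne'
  have h2 := Int.emod_lt_of_pos a hn
  have h3 : a + -(a / n) * n = a % n := by
    have := Int.emod_add_mul_ediv a n
    linarith
  rw [← hinv'] at hac hbd ⊢
  exact key _ _ _ _ (by omega) (by omega) (by omega) (by omega) (by omega) (by omega) hac hbd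

open Classical in
/-- The set partition of `[n]` obtained by restricting a relation on `ℤ`. -/
noncomputable def ofIntRel (n : ℕ) (s : Setoid ℤ) : SetPartition n :=
  Finpartition.ofSetoid (s.comap fun a : Fin n => (a : ℤ))

theorem part_ofIntRel_eq_iff {s : Setoid ℤ} {a b : Fin n} :
    (ofIntRel n s).part a = (ofIntRel n s).part b ↔ s a b := by
  classical
  rw [← Finpartition.mem_part_iff_part_eq_part _ (Finset.mem_univ _) (Finset.mem_univ _), ofIntRel,
    Finpartition.mem_part_ofSetoid_iff_rel, Setoid.comap_rel]
  exact ⟨s.symm', s.symm'⟩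

theorem cyclicRel_ofIntRel [NeZero n] (s : Setoid ℤ) (x y : ℤ) :
    (ofIntRel n s).cyclicRel x y ↔ s (x % n) (y % n) := by
  rw [cyclicRel_apply, part_ofIntRel_eq_iff, coe_residue, coe_residue]

theorem ofIntRel_isNoncrossing {s : Setoid ℤ}
    (hs : ∀ a b c d : ℤ, a < b → b < c → c < d → d < a + n → s a c → s b d → s a b) :
    (ofIntRel n s).IsNoncrossing := by
  rw [isNoncrossing_iff_part]
  intro a b c d hab hbc hcd hac hbd
  rw [part_ofIntRel_eq_iff] at *
  rw [Fin.lt_def] at hab hbc hcd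
  exact hs a b c d (by omega) (by omega) (by omega) (by omega) hac hbd

theorem cyclicRel_ofIntRel_of_isCyclicNC [NeZero n] {s : Setoid ℤ} (hs : s.IsCyclicNC n) :
    (ofIntRel n s).cyclicRel = s := by
  ext x y
  have h : ∀ x : ℤ, s (x % n) x := fun x => by
    have := hs.rel_add_mul (x % n) (x / n)
    rwa [mul_comm, Int.emod_add_mul_ediv] at this
  rw [cyclicRel_ofIntRel]
  exact ⟨fun h' => s.trans' (s.symm' (h x)) (s.trans' h' (h y)),
    fun h' => s.trans' (h x) (s.trans' h' (s.symm' (h y)))⟩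

end SetPartition

/-! ### Counting noncrossing partitions -/

section

variable {n : ℕ} [NeZero n]

theorem card_NC : Nat.card (NC n) = catalan n := by
  have hn := NeZero.pos n
  have hn' : (0 : ℤ) < n := by exact_mod_cast hn
  have hdiv : ∀ x, x / (n : ℤ) * n ≤ x ∧ x < x / (n : ℤ) * n + n := fun x => by
    have h1 := Int.emod_nonneg x hn'.ne'
    have h2 := Int.emod_lt_of_pos x hn'
    have h3 := Int.emod_add_mul_ediv x n
    rw [mul_comm] at h3
    omega
  rw [← card_ballotPairs, ← card_blockNC hn]
  -- The pullback is cut at the multiples of n, leaving a copy of the partition in each period.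
  refine Nat.card_eq_of_bijective (fun π : NC n => (⟨⟨π.1.cyclicRel ⊓ Setoid.ker (fun x => x / (n : ℤ)),
    ?_, ?_⟩, fun x y h => h.2⟩ : {s : PeriodicNC n // ∀ x y, s.1 x y → x / n = y / n})) ⟨?_, ?_⟩
  · intro x y
    refine and_congr (π.2.isCyclicNC.isShiftInvariant x y) ?_
    change (x + n) / n = (y + n) / n ↔ x / n = y / n
    rw [Int.add_ediv_of_dvd_right dvd_rfl, Int.add_ediv_of_dvd_right dvd_rfl, add_left_inj]
  · rintro a b c d hab hbc hcd ⟨hac, hac' : a / n = c / n⟩ ⟨hbd, hbd' : b / n = d / n⟩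
    have h1 : a / (n : ℤ) ≤ b / n := Int.ediv_le_ediv hn' hab.le
    have h2 : b / (n : ℤ) ≤ c / n := Int.ediv_le_ediv hn' hbc.le
    have h3 : a / (n : ℤ) = b / n := by omega
    have ha := hdiv a
    have hd := hdiv d
    rw [← hbd', ← h3] at hd
    exact ⟨π.2.isCyclicNC.2 a b c d hab hbc hcd (by omega) hac hbd, h3⟩
  · intro π π' h
    refine Subtype.ext (Finpartition.eq_of_part_eq_iff fun a b => ?_)
    have h1 : π.1.cyclicRel ⊓ Setoid.ker (fun x => x / (n : ℤ)) =
      π'.1.cyclicRel ⊓ Setoid.ker (fun x => x / (n : ℤ)) := congrArg (fun s => s.1.1) h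
    have h2 : ((a : ℤ)) / n = (b : ℤ) / n := by
      rw [Int.ediv_eq_zero_of_lt (by omega) (by omega), Int.ediv_eq_zero_of_lt (by omega) (by omega)]
    have h3 : ∀ π : NC n, (π.1.cyclicRel ⊓ Setoid.ker (fun x => x / (n : ℤ))) a b ↔
        π.1.part a = π.1.part b := fun π => by
      have := SetPartition.cyclicRel_apply π.1 a b
      rw [SetPartition.residue_coe, SetPartition.residue_coe] at this
      rw [← this]
      exact and_iff_left h2
    rw [← h3, ← h3, h1]
  · rintro ⟨⟨s, hs, hnc⟩, hb⟩
    refine ⟨⟨SetPartition.ofIntRel n s, SetPartition.ofIntRel_isNoncrossing (s := s)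
      fun a b c d hab hbc hcd _ => hnc a b c d hab hbc hcd⟩, Subtype.ext (Subtype.ext ?_)⟩
    ext x y
    have h1 : x / (n : ℤ) = y / n → (s (x % n) (y % n) ↔ s x y) := by
      intro h
      rw [← hs.mul (x / n)]
      nth_rw 2 [h]
      rw [mul_comm, mul_comm (y / _), Int.emod_add_mul_ediv, Int.emod_add_mul_ediv]
    change (SetPartition.ofIntRel n s).cyclicRel x y ∧ x / n = y / n ↔ s x y
    rw [SetPartition.cyclicRel_ofIntRel]
    exact ⟨fun ⟨h2, h3⟩ => (h1 h3).1 h2, fun h => ⟨(h1 (hb x y h)).2 h, hb x y h⟩⟩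

theorem mem_fixedBy_NC_iff {d : ℕ} {π : NC n} :
    π ∈ MulAction.fixedBy (NC n) (longCycle n ^ d) ↔ π.1.cyclicRel.IsShiftInvariant d := by
  rw [← SetPartition.finRotate_pow_smul_eq_iff, MulAction.mem_fixedBy, Subtype.ext_iff]
  rfl

omit [NeZero n] in
theorem Setoid.IsCyclicNC.isShiftInvariant_gcd_iff {s : Setoid ℤ} (hs : s.IsCyclicNC n) (d : ℕ) :
    s.IsShiftInvariant d ↔ s.IsShiftInvariant (n.gcd d : ℕ) := by
  constructor
  · intro h
    rw [Nat.gcd_eq_gcd_ab, mul_comm, mul_comm (d : ℤ)]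
    exact (hs.isShiftInvariant.mul _).add (h.mul _)
  · intro h
    obtain ⟨k, hk⟩ := Nat.gcd_dvd_right n d
    have := h.mul k
    rwa [← Nat.cast_mul, mul_comm, ← hk] at this

/-- The condition 2 ≤ m provides 2g ≤ n, on which cutting into short pieces depends. Fixed
partitions then correspond to `PeriodicNC g`. -/
theorem card_fixedBy_longCycle_pow {m g d : ℕ} (hm : 2 ≤ m) (hn : n = m * g)
    (hd : n.gcd d = g) :
    Nat.card (MulAction.fixedBy (NC n) (longCycle n ^ d)) = g.centralBinom := by
  have hg : 0 < g := by
    have := NeZero.pos n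
    exact Nat.pos_of_ne_zero (by rintro rfl; omega)
  have hg' : (0 : ℤ) < g := by exact_mod_cast hg
  have hm' : (2 : ℤ) ≤ m := by exact_mod_cast hm
  have hgn : 2 * (g : ℤ) ≤ n := by
    rw [hn]
    push_cast
    gcongr
  have hnmg : (n : ℤ) = m * g := by exact_mod_cast hn
  have hinv : ∀ π : NC n, π ∈ MulAction.fixedBy (NC n) (longCycle n ^ d) ↔
      π.1.cyclicRel.IsShiftInvariant g := fun π => by
    rw [mem_fixedBy_NC_iff, π.2.isCyclicNC.isShiftInvariant_gcd_iff, hd]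
  rw [← card_periodicNC hg]
  refine Nat.card_eq_of_bijective (fun π : MulAction.fixedBy (NC n) (longCycle n ^ d) =>
    (⟨π.1.1.cyclicRel.shortRel π.1.2.isCyclicNC ((hinv _).1 π.2) hg' hgn,
      Setoid.shortRel_isShiftInvariant _ _ _ _, Setoid.shortRel_isIntNoncrossing _ _ _ _⟩ :
      PeriodicNC g)) ⟨?_, ?_⟩
  · intro π π' h
    refine Subtype.ext (Subtype.ext (SetPartition.cyclicRel_injective (Setoid.ext fun x y => ?_)))
    rw [Setoid.rel_iff_exists_shortRel π.1.2.isCyclicNC ((hinv _).1 π.2) hg' hgn,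
      Setoid.rel_iff_exists_shortRel π'.1.2.isCyclicNC ((hinv _).1 π'.2) hg' hgn,
      show π.1.1.cyclicRel.shortRel π.1.2.isCyclicNC ((hinv _).1 π.2) hg' hgn =
        π'.1.1.cyclicRel.shortRel π'.1.2.isCyclicNC ((hinv _).1 π'.2) hg' hgn from
        congrArg Subtype.val h]
  · rintro ⟨s, hs, hnc⟩
    -- The relation t is the reduction of s modulo n, and its restriction to [n] is the preimage
    -- sought.
    obtain ⟨t, hcyc, hshift, hshort⟩ : ∃ (t : Setoid ℤ) (hc : t.IsCyclicNC (m * g))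
        (ht : t.IsShiftInvariant g), t.shortRel hc ht hg' (hnmg ▸ hgn) = s :=
      ⟨_, _, _, Setoid.shortRel_modRel hs hnc hg' hm' (hnmg ▸ hgn)⟩
    have hrel := SetPartition.cyclicRel_ofIntRel_of_isCyclicNC (n := n) (s := t)
      (by rwa [hnmg])
    have hnct : (SetPartition.ofIntRel n t).IsNoncrossing :=
      SetPartition.ofIntRel_isNoncrossing (by rw [hnmg]; exact hcyc.2)
    refine ⟨⟨⟨SetPartition.ofIntRel n t, hnct⟩, (hinv _).2 (by rwa [hrel])⟩, Subtype.ext ?_⟩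
    refine Eq.trans (Setoid.ext fun x y => ?_) hshort
    simp only [Setoid.shortRel_apply]
    change (SetPartition.ofIntRel n t).cyclicRel x y ∧
      ((SetPartition.ofIntRel n t).cyclicRel x (x + g) ∨ _) ↔ _
    rw [hrel]

end

theorem theorem1p1 (n : ℕ) :
    ∃ P : Polynomial ℕ,
      algebraMap (Polynomial ℚ) (RatFunc ℚ) (P.map (Nat.castRingHom ℚ)) = qCatalan n ∧
      ExhibitsCSP (NC n) (longCycle n) P := by
  obtain ⟨P, hP⟩ := exists_natPoly_eq_qCatalan n
  refine ⟨P, hP, ?_, inferInstance, ?_, ?_⟩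
  · classical
    exact Finite.of_injective (fun π : NC n => π.1.parts)
      fun π π' h => Subtype.ext (Finpartition.ext h)
  · rw [eq_top_iff]
    rintro ⟨w, hw⟩ -
    obtain ⟨k, rfl⟩ := Subgroup.mem_zpowers_iff.1 hw
    exact Subgroup.mem_zpowers_iff.2 ⟨k, rfl⟩
  · intro ζ hζ d
    obtain rfl | hn := n.eq_zero_or_pos
    -- For n = 0 the group has order 1 rather than n, so ζ = 1.
    · have hcard : Nat.card (rotationGroup 0) = 1 := Nat.card_unique
      rw [hcard, IsPrimitiveRoot.one_right_iff] at hζ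
      rw [hζ, one_pow, aeval_qCatalan_one hP]
      have : Subsingleton (NC 0) := ⟨fun π π' => Subtype.ext
        (Finpartition.eq_of_part_eq_iff fun a => a.elim0)⟩
      have : MulAction.fixedBy (NC 0) (longCycle 0 ^ d) = Set.univ :=
        Set.eq_univ_of_forall fun π => Subsingleton.elim _ _
      have hne : Nonempty (NC 0) := ⟨⟨⊥, fun a => a.elim0⟩⟩
      rw [this, Nat.card_univ, Nat.card_eq_one_iff_unique.2 ⟨inferInstance, hne⟩, catalan_zero]
    · have : NeZero n := ⟨hn.ne'⟩
      rw [card_rotationGroup hn] at hζ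
      -- The cofactor m = n / gcd(n, d) is the order of ζ^d.
      obtain ⟨m, hm⟩ := Nat.gcd_dvd_left n d
      have hg : 0 < n.gcd d := Nat.gcd_pos_of_pos_left d hn
      obtain rfl | hm2 : m = 1 ∨ 2 ≤ m := by
        have : m ≠ 0 := by rintro rfl; omega
        omega
      · have hd : n ∣ d := by
          rw [mul_one] at hm
          exact Nat.gcd_eq_left_iff_dvd.1 hm.symm
        rw [(hζ.pow_eq_one_iff_dvd d).2 hd, aeval_qCatalan_one hP, ← card_NC]
        have : MulAction.fixedBy (NC n) (longCycle n ^ d) = Set.univ := by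
          refine Set.eq_univ_of_forall fun π => mem_fixedBy_NC_iff.2 ?_
          obtain ⟨k, rfl⟩ := hd
          rw [Nat.cast_mul, mul_comm]
          exact π.2.isCyclicNC.isShiftInvariant.mul k
        rw [this, Nat.card_univ]
      · have hprim : IsPrimitiveRoot (ζ ^ d) m := by
          have h1 : orderOf (ζ ^ d) = m := by
            rw [(hζ.isOfFinOrder hn.ne').orderOf_pow, ← hζ.eq_orderOf]
            exact Nat.div_eq_of_eq_mul_right hg hm
          rw [← h1]
          exact IsPrimitiveRoot.orderOf _
        rw [mul_comm] at hm
        rw [card_fixedBy_longCycle_pow hm2 hm rfl,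
          aeval_qCatalan_of_isPrimitiveRoot hm2 (by rwa [← hm]) hprim]
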